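/- Let $Z$ be a connected orbifold of dimension $m$ (second countable, Hausdorff), and let $\pi:\mathcal F\to Z$ be the total space of a flat complex orbifold vector bundle $F$ of rank $R$ on $Z$, proper or not. Thus there is an orbifold atlas $\{(\widetilde U,G_U,\pi_U)\}_{U\in\mathcal U}$ of $Z$ with, for each $U$, a finite group $G_U^F$, a surjection $G_U^F\to G_U$ (possibly with nontrivial kernel), a representation of $G^F_U$ on $\mathbf C^R$ and a map $\pi_U^F:\widetilde U\times\mathbf C^R\to\pi^{-1}(U)$ over $\pi_U$, such that $(\widetilde U\times\mathbf C^R,G_U^F,\pi_U^F)$ is an orbifold chart of $\mathcal F$, and such that these charts are related by embeddings $(x,v)\mapsto(\phi(x),g\,v)$ with $\phi$ an embedding of orbifold charts and $g\in \mathrm{GL}_R(\mathbf C)$ constant. Let $C^\infty(Z,F)$ be the space of smooth sections, i.e. of maps $s:Z\to\mathcal F$ with $\pi\circ s=\mathrm{id}$ having smooth $G^F_U$-invariant lifts $\widetilde U\to\widetilde U\times\mathbf C^R$ over $\mathrm{id}_{\widetilde U}$. Let $\mathcal G$ be the groupoid of germs of coordinate transformations of this atlas, with objects $\coprod_U\widetilde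 U$; let $x_0$ be an object, let $\Gamma=\pi_1^{\rm orb}(Z,x_0)$ be the orbifold fundamental group (homotopy classes of $\mathcal G$-loops at $x_0$), and let $p:X\to Z$ be the universal covering orbifold (homotopy classes of $\mathcal G$-paths starting at $x_0$, modulo the arrows of $\mathcal G$ at the end point), with its left $\Gamma$-action. Let $V_U\subset\mathbf C^R$ be the subspace fixed by $\ker(G^F_U\to G_U)$; the spaces $V_U$ are the fibres of the proper flat subbundle $F^{\rm pr}$ of $F$. Then there are an integer $r$, equal to $\dim V_U$ for every $U$ (the rank of $F^{\rm pr}$; so $r=R$ if $F$ is proper), and a representation $\rho:\Gamma\to\mathrm{GL}_r(\mathbf C)$ such that $$C^\infty(Z,F)=C^\infty(X,\mathbf C^r)^\Gamma,\qquad C^\infty(X,\mathbf C^r)^\Gamma=\{f\in C^\infty(X,\mathbf C^r): f(\gamma x)=\rho(\gamma)f(x)\ \text{ for all } \gamma\in\Gamma,\ x\in X\},$$ in the following sense. There is a map $\Phi:X\times\mathbf C^r\to\mathcal F$ with $\Phi(\gamma x,\rho(\gamma)v)=\Phi(x,v)$ such that 1. for every homotopy class $q$ of $\mathcal G$-paths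 from $x_0$ to a point of a chart $\widetilde U$ there is an injective $\mathbf C$-linear map $T:\mathbf C^r\to\mathbf C^R$ with image $V_U$ such that $\Phi([q\cdot b],v)=\pi^F_U(w,Tv)$ for all $v\in\mathbf C^r$ and all paths $b$ in $\widetilde U$ from the end point of $q$ to a point $w$; 2. there is an isomorphism of complex vector spaces $s\mapsto f$ from $C^\infty(Z,F)$ onto $C^\infty(X,\mathbf C^r)^\Gamma$ with $s(p(x))=\Phi(x,f(x))$ for all $x\in X$. -/

import Mathlib

open CategoryTheory Topology
open scoped ContDiff unitInterval

noncomputable section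

namespace Orbifold

/-- The model space `ℝ^m`. -/
abbrev Model (m : ℕ) := EuclideanSpace ℝ (Fin m)

/-! ### Orbifold charts and atlases -/

/-- An `m`-dimensional orbifold chart `(Ũ, G_U, π_U)` of the space `Z`: `dom = Ũ` is a connected open
subset of `ℝ^m`, the finite group `G` acts smoothly and effectively on `Ũ`, and `proj = π_U`
induces a homeomorphism from `G \ Ũ` onto the open set `U = π_U(Ũ)` (it is continuous, open, and its
fibres are the orbits).  The values of `act` and `proj` outside `dom` are irrelevant. -/
structure Chart (Z : Type*) [TopologicalSpace Z] (m : ℕ) where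
  dom : Set (Model m)
  isOpen_dom : IsOpen dom
  isConnected_dom : IsConnected dom
  G : Type
  [group : Group G]
  [finite : Finite G]
  act : G → Model m → Model m
  act_mem : ∀ g, ∀ x ∈ dom, act g x ∈ dom
  act_one : ∀ x ∈ dom, act 1 x = x
  act_mul : ∀ g h, ∀ x ∈ dom, act (g * h) x = act g (act h x)
  act_smooth : ∀ g, ContDiffOn ℝ ∞ (act g) dom
  act_effective : ∀ g, (∀ x ∈ dom, act g x = x) → g = 1
  proj : Model m → Z
  proj_continuousOn : ContinuousOn proj dom
  proj_isOpen : ∀ W ⊆ dom, IsOpen W → IsOpen (proj '' W)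
  proj_eq_iff : ∀ x ∈ dom, ∀ y ∈ dom, proj x = proj y ↔ ∃ g, act g x = y

attribute [instance] Chart.group Chart.finite

/-- The open subset `U = π_U(Ũ)` of `Z` covered by a chart. -/
def Chart.image {Z : Type*} [TopologicalSpace Z] {m : ℕ} (c : Chart Z m) : Set Z := c.proj '' c.dom

/-- `φ` is an embedding of orbifold charts `c ↪ d`: a smooth embedding of the domains which commutes
with the projections to `Z`.  (The dimensions agree, so an injective immersion is an open
embedding.) -/
structure IsChartEmbedding {Z : Type*} [TopologicalSpace Z] {m : ℕ} (c d : Chart Z m)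
    (φ : Model m → Model m) : Prop where
  mapsTo : Set.MapsTo φ c.dom d.dom
  injOn : Set.InjOn φ c.dom
  smooth : ContDiffOn ℝ ∞ φ c.dom
  immersion : ∀ x ∈ c.dom, Function.Injective (fderiv ℝ φ x)
  proj_map : ∀ x ∈ c.dom, d.proj (φ x) = c.proj x

/-- Compatibility of two orbifold charts. -/
def Compatible {Z : Type*} [TopologicalSpace Z] {m : ℕ} (c d : Chart Z m) : Prop :=
  ∀ z ∈ c.image ∩ d.image, ∃ (e : Chart Z m) (φ ψ : Model m → Model m),
    z ∈ e.image ∧ e.image ⊆ c.image ∩ d.image ∧ IsChartEmbedding e c φ ∧ IsChartEmbedding e d ψ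

/-- An orbifold atlas on `Z`, with charts indexed by `ι`. -/
structure OrbifoldAtlas (ι : Type*) (Z : Type*) [TopologicalSpace Z] (m : ℕ) where
  chart : ι → Chart Z m
  cover : ∀ z, ∃ i, z ∈ (chart i).image
  compatible : ∀ i j, Compatible (chart i) (chart j)

/-! ### The étale groupoid of an atlas -/

section Groupoid

variable {ι Z : Type*} [TopologicalSpace Z] {m : ℕ}

/-- The objects `𝒢₀ = ∐ Ũ` of the groupoid of the atlas. -/
@[ext]
structure Obj (A : OrbifoldAtlas ι Z m) where
  idx : ι
  pt : Model m
  mem : pt ∈ (A.chart idx).dom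

/-- The topology of the disjoint union. -/
instance (A : OrbifoldAtlas ι Z m) : TopologicalSpace (Obj A) :=
  TopologicalSpace.induced
    (fun x => (⟨x.idx, x.pt, x.mem⟩ : Σ i : ι, (A.chart i).dom)) inferInstance

/-- The point of `Z` below an object. -/
def Obj.toBase {A : OrbifoldAtlas ι Z m} (x : Obj A) : Z := (A.chart x.idx).proj x.pt

/-- A coordinate transformation from the chart `i` to the chart `j`: a diffeomorphism from an open
subset of `Ũ_i` onto an open subset of `Ũ_j` commuting with the projections to `Z`.  (Near each point
it is of the form `φ_j ∘ φ_i⁻¹` for two embeddings of a common chart, and all such composites are of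
this kind.) -/
structure Change (A : OrbifoldAtlas ι Z m) (i j : ι) where
  map : OpenPartialHomeomorph (Model m) (Model m)
  source_subset : map.source ⊆ (A.chart i).dom
  target_subset : map.target ⊆ (A.chart j).dom
  smooth : ContDiffOn ℝ ∞ map map.source
  smooth_symm : ContDiffOn ℝ ∞ map.symm map.target
  proj_map : ∀ x ∈ map.source, (A.chart j).proj (map x) = (A.chart i).proj x

namespace Change

variable {A : OrbifoldAtlas ι Z m}

/-- The identity coordinate transformation. -/
def id (A : OrbifoldAtlas ι Z m) (i : ι) : Change A i i where
  map := OpenPartialHomeomorph.ofSet (A.chart i).dom (A.chart i).isOpen_dom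
  source_subset := by simp
  target_subset := by simp
  smooth := by simpa using contDiffOn_id
  smooth_symm := by simpa using contDiffOn_id
  proj_map := by simp

/-- The composite of coordinate transformations, defined where it makes sense. -/
def trans {i j k : ι} (e : Change A i j) (f : Change A j k) : Change A i k where
  map := e.map.trans f.map
  source_subset := fun x hx => e.source_subset (by
    rw [OpenPartialHomeomorph.trans_source] at hx; exact hx.1)
  target_subset := fun x hx => f.target_subset (by
    rw [OpenPartialHomeomorph.trans_target] at hx; exact hx.1)
  smooth := by
    rw [OpenPartialHomeomorph.coe_trans, OpenPartialHomeomorph.trans_source]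
    exact f.smooth.comp (e.smooth.mono Set.inter_subset_left) (fun x hx => hx.2)
  smooth_symm := by
    rw [OpenPartialHomeomorph.coe_trans_symm, OpenPartialHomeomorph.trans_target]
    exact e.smooth_symm.comp (f.smooth_symm.mono Set.inter_subset_left) (fun x hx => hx.2)
  proj_map := fun x hx => by
    rw [OpenPartialHomeomorph.trans_source] at hx
    rw [OpenPartialHomeomorph.coe_trans, Function.comp_apply, f.proj_map _ hx.2, e.proj_map _ hx.1]

/-- The inverse coordinate transformation. -/
def symm {i j : ι} (e : Change A i j) : Change A j i where
  map := e.map.symm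
  source_subset := e.target_subset
  target_subset := e.source_subset
  smooth := e.smooth_symm
  smooth_symm := by simpa using e.smooth
  proj_map := fun x hx => by
    have h := e.proj_map (e.map.symm x) (e.map.map_target hx)
    rw [e.map.right_inv hx] at h
    exact h.symm

end Change

/-- Coordinate transformations defined near `x` and sending `x` to `y`. -/
def LocalChange {A : OrbifoldAtlas ι Z m} (x y : Obj A) : Type :=
  {e : Change A x.idx y.idx // x.pt ∈ e.map.source ∧ e.map x.pt = y.pt}

theorem LocalChange.mem_target {A : OrbifoldAtlas ι Z m} {x y : Obj A} (e : LocalChange x y) :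
    y.pt ∈ e.1.map.target :=
  (congrArg (· ∈ e.1.map.target) e.2.2).mp (e.1.map.map_source e.2.1)

theorem LocalChange.symm_apply {A : OrbifoldAtlas ι Z m} {x y : Obj A} (e : LocalChange x y) :
    e.1.map.symm y.pt = x.pt :=
  (congrArg e.1.map.symm e.2.2).symm.trans (e.1.map.left_inv e.2.1)

/-- Having the same germ at the source point. -/
instance germSetoid {A : OrbifoldAtlas ι Z m} (x y : Obj A) : Setoid (LocalChange x y) where
  r e f := e.1.map =ᶠ[𝓝 x.pt] f.1.map
  iseqv := ⟨fun _ => Filter.EventuallyEq.rfl, fun h => h.symm, fun h h' => h.trans h'⟩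

/-- The groupoid `𝒢` of the atlas: the arrows `x ⟶ y` are the germs at `x` of the coordinate
transformations which send `x` to `y`. -/
instance (A : OrbifoldAtlas ι Z m) : Groupoid (Obj A) where
  Hom x y := Quotient (germSetoid x y)
  id x := ⟦⟨Change.id A x.idx, x.mem, rfl⟩⟧
  comp {x y z} := Quotient.map₂
    (fun e f => ⟨e.1.trans f.1, by
      change _ ∈ (e.1.map.trans f.1.map).source
      rw [OpenPartialHomeomorph.trans_source]
      exact ⟨e.2.1, by rw [Set.mem_preimage, e.2.2]; exact f.2.1⟩, by
      change f.1.map (e.1.map x.pt) = z.pt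
      rw [e.2.2, f.2.2]⟩)
    (by
      intro e e' h f f' h'
      change (f.1.map ∘ e.1.map) =ᶠ[𝓝 x.pt] (f'.1.map ∘ e'.1.map)
      have ht : Filter.Tendsto e'.1.map (𝓝 x.pt) (𝓝 y.pt) := by
        have := (e'.1.map.continuousAt e'.2.1).tendsto
        rwa [e'.2.2] at this
      have h1 : f.1.map =ᶠ[𝓝 y.pt] f'.1.map := h'
      have h0 : e.1.map =ᶠ[𝓝 x.pt] e'.1.map := h
      filter_upwards [h0, ht.eventually h1] with p hp hp'
      simp only [Function.comp_apply, hp, hp'])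
  inv {x y} := Quotient.map
    (fun e => ⟨e.1.symm, e.mem_target, e.symm_apply⟩)
    (by
      intro e e' h
      change e.1.map.symm =ᶠ[𝓝 y.pt] e'.1.map.symm
      have h0 : e.1.map =ᶠ[𝓝 x.pt] e'.1.map := h
      have hy : y.pt ∈ e.1.map.target := e.mem_target
      have hy' : y.pt ∈ e'.1.map.target := e'.mem_target
      have hs : e.1.map.symm y.pt = x.pt := e.symm_apply
      have ht : Filter.Tendsto e.1.map.symm (𝓝 y.pt) (𝓝 x.pt) := by
        have := (e.1.map.symm.continuousAt (x := y.pt) hy).tendsto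
        rwa [hs] at this
      filter_upwards [ht.eventually h0, e.1.map.open_target.mem_nhds hy,
        ht.eventually (e'.1.map.open_source.mem_nhds e'.2.1)] with p hp hpt hps
      rw [e.1.map.right_inv hpt] at hp
      conv_rhs => rw [hp]
      exact (e'.1.map.left_inv hps).symm)
  id_comp := by rintro x y ⟨e⟩; exact Quotient.sound Filter.EventuallyEq.rfl
  comp_id := by rintro x y ⟨e⟩; exact Quotient.sound Filter.EventuallyEq.rfl
  assoc := by rintro x y z w ⟨e⟩ ⟨f⟩ ⟨g⟩; exact Quotient.sound Filter.EventuallyEq.rfl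
  inv_comp := by
    rintro x y ⟨e⟩
    refine Quotient.sound ?_
    change (e.1.map ∘ e.1.map.symm) =ᶠ[𝓝 y.pt] _root_.id
    have hy : y.pt ∈ e.1.map.target := e.mem_target
    filter_upwards [e.1.map.open_target.mem_nhds hy] with p hp
    exact e.1.map.right_inv hp
  comp_inv := by
    rintro x y ⟨e⟩
    refine Quotient.sound ?_
    change (e.1.map.symm ∘ e.1.map) =ᶠ[𝓝 x.pt] _root_.id
    filter_upwards [e.1.map.open_source.mem_nhds e.2.1] with p hp
    exact e.1.map.left_inv hp

/-- Arrows lie over the identity of `Z`. -/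
theorem toBase_eq_of_hom {A : OrbifoldAtlas ι Z m} {x y : Obj A} (g : x ⟶ y) :
    x.toBase = y.toBase := by
  obtain ⟨e, h1, h2⟩ := Quotient.out g
  have := e.proj_map _ h1
  rw [h2] at this
  exact this.symm

/-- The space `𝒢₁` of all arrows. -/
structure Arrow (A : OrbifoldAtlas ι Z m) where
  src : Obj A
  tgt : Obj A
  hom : src ⟶ tgt

/-- The arrow given by the germ of a coordinate transformation at a point of its source. -/
def Change.germAt {A : OrbifoldAtlas ι Z m} {i j : ι} (e : Change A i j) (x : Model m)
    (hx : x ∈ e.map.source) : Arrow A where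
  src := ⟨i, x, e.source_subset hx⟩
  tgt := ⟨j, e.map x, e.target_subset (e.map.map_source hx)⟩
  hom := ⟦⟨e, hx, rfl⟩⟧

/-- The germ topology of `𝒢₁`, with basis the sets of all germs of one coordinate transformation. -/
instance (A : OrbifoldAtlas ι Z m) : TopologicalSpace (Arrow A) :=
  TopologicalSpace.generateFrom
    {S | ∃ (i j : ι) (e : Change A i j), S = {a | ∃ x hx, a = e.germAt x hx}}

end Groupoid

/-! ### `𝒢`-paths and their homotopy -/

section Paths

variable {ι Z : Type*} [TopologicalSpace Z] {m : ℕ} {A : OrbifoldAtlas ι Z m}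

/-- A `𝒢`-path `(b₁, …, b_k; g₀, …, g_k)`, `k ≥ 1`, from `x` to `w`: arrows `g₀ : x ⟶ b₁(0)`,
`g_i : b_i(1) ⟶ b_{i+1}(0)`, `g_k : b_k(1) ⟶ w`.  The continuous path `b_i`, given on the `i`-th
interval of a partition of `[0,1]`, is parametrized here by `[0,1]` (by affine rescaling). -/
inductive GPath : Obj A → Obj A → Type _
  | single {x y z w : Obj A} (g : x ⟶ y) (b : Path y z) (g' : z ⟶ w) : GPath x w
  | cons {x y z w : Obj A} (g : x ⟶ y) (b : Path y z) (c : GPath z w) : GPath x w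

namespace GPath

/-- The list `b₁, …, b_k`. -/
def paths : {x w : Obj A} → GPath x w → List (I → Obj A)
  | _, _, single _ b _ => [b]
  | _, _, cons _ b c => (b : I → Obj A) :: c.paths

/-- The list `g₀, …, g_k`. -/
def arrows : {x w : Obj A} → GPath x w → List (Arrow A)
  | _, _, single g _ g' => [⟨_, _, g⟩, ⟨_, _, g'⟩]
  | _, _, cons g _ c => ⟨_, _, g⟩ :: c.arrows

/-- Replace `g₀` by `g₀ h` (first `h`, then `g₀`). -/
def precomp {x' x w : Obj A} (h : x' ⟶ x) : GPath x w → GPath x' w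
  | single g b g' => single (h ≫ g) b g'
  | cons g b c => cons (h ≫ g) b c

/-- The composite `c c'` (first `c`, then `c'`). -/
def comp : {x y w : Obj A} → GPath x y → GPath y w → GPath x w
  | _, _, _, single g b g', d => cons g b (d.precomp g')
  | _, _, _, cons g b c, d => cons g b (c.comp d)

/-- The inverse `𝒢`-path. -/
def inv : {x w : Obj A} → GPath x w → GPath w x
  | _, _, single g b g' => single (Groupoid.inv g') b.symm (Groupoid.inv g)
  | _, _, cons g b c => c.inv.comp (single (𝟙 _) b.symm (Groupoid.inv g))

/-- An elementary homotopy: a family `c^s = (b₁^s, …, b_k^s; g₀^s, …, g_k^s)`, `s ∈ [0,1]`, of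
`𝒢`-paths with `k`, `g₀^s` and `g_k^s` independent of `s` and `b_i^s`, `g_i^s` depending
continuously on `s`. -/
def ElementaryHomotopy {x w : Obj A} (c c' : GPath x w) : Prop :=
  ∃ (C : I → GPath x w) (B : List C(I × I, Obj A)) (g : List C(I, Arrow A)),
    C 0 = c ∧ C 1 = c' ∧
    (∀ s, (C s).paths = B.map fun β u => β (s, u)) ∧
    (∀ s, (C s).arrows = g.map fun γ => γ s) ∧
    (∀ s, (C s).arrows.head? = c.arrows.head?) ∧
    (∀ s, (C s).arrows.getLast? = c.arrows.getLast?)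

/-- `h₀` and `h₁` are the ends of a continuous family of arrows `h_u : b(u) ⟶ b'(u)`. -/
def ArrowAlong {y z y' z' : Obj A} (b : Path y z) (b' : Path y' z') (h₀ : y ⟶ y') (h₁ : z ⟶ z') :
    Prop :=
  ∃ H : C(I, Arrow A), (∀ u, (H u).src = b u ∧ (H u).tgt = b' u) ∧
    H 0 = ⟨y, y', h₀⟩ ∧ H 1 = ⟨z, z', h₁⟩

/-- The moves generating homotopy of `𝒢`-paths: subdivision, replacement of `(b, g, g')` by
`(h b, h g, g' h⁻¹)`, and elementary homotopy. The first two may be applied at any position. -/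
inductive Step : {x w : Obj A} → GPath x w → GPath x w → Prop
  | subdivide_last {x y z t w : Obj A} (g : x ⟶ y) (p : Path y z) (q : Path z t) (g' : t ⟶ w) :
      Step (single g (p.trans q) g') (cons g p (single (𝟙 z) q g'))
  | subdivide {x y z t w : Obj A} (g : x ⟶ y) (p : Path y z) (q : Path z t) (c : GPath t w) :
      Step (cons g (p.trans q) c) (cons g p (cons (𝟙 z) q c))
  | change_last {x y z y' z' w : Obj A} (g : x ⟶ y) (b : Path y z) (g' : z ⟶ w)
      (b' : Path y' z') (h₀ : y ⟶ y') (h₁ : z ⟶ z') (H : ArrowAlong b b' h₀ h₁) :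
      Step (single g b g') (single (g ≫ h₀) b' (Groupoid.inv h₁ ≫ g'))
  | change {x y z y' z' w : Obj A} (g : x ⟶ y) (b : Path y z) (c : GPath z w)
      (b' : Path y' z') (h₀ : y ⟶ y') (h₁ : z ⟶ z') (H : ArrowAlong b b' h₀ h₁) :
      Step (cons g b c) (cons (g ≫ h₀) b' (c.precomp (Groupoid.inv h₁)))
  | tail {x y z w : Obj A} (g : x ⟶ y) (b : Path y z) {c c' : GPath z w} (h : Step c c') :
      Step (cons g b c) (cons g b c')
  | homotopy {x w : Obj A} {c c' : GPath x w} (h : ElementaryHomotopy c c') : Step c c'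

end GPath

/-- Homotopy classes of `𝒢`-paths from `x` to `w` (classes for the equivalence relation generated by
`GPath.Step`). -/
def PathClass (x w : Obj A) : Type _ := Quot (GPath.Step (x := x) (w := w))

/-! #### Elementary facts, used to see that composition descends to homotopy classes -/

namespace GPath

theorem precomp_precomp {x x' x'' w : Obj A} (h : x'' ⟶ x') (h' : x' ⟶ x) (c : GPath x w) :
    (c.precomp h').precomp h = c.precomp (h ≫ h') := by
  cases c <;> simp [precomp]

theorem precomp_id {x w : Obj A} (c : GPath x w) : c.precomp (𝟙 x) = c := by
  cases c <;> simp [precomp]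

theorem precomp_comp {x' x y w : Obj A} (h : x' ⟶ x) (c : GPath x y) (d : GPath y w) :
    (c.comp d).precomp h = (c.precomp h).comp d := by
  cases c <;> simp [precomp, comp]

theorem comp_assoc {x y z w : Obj A} (a : GPath x y) (b : GPath y z) (c : GPath z w) :
    (a.comp b).comp c = a.comp (b.comp c) := by
  induction a with
  | single g p g' => simp [comp, precomp_comp]
  | cons g p a ih => simp [comp, ih]

/-- The last arrow. -/
def last : {x w : Obj A} → GPath x w → Σ y : Obj A, (y ⟶ w)
  | _, _, single _ _ g' => ⟨_, g'⟩
  | _, _, cons _ _ c => c.last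

theorem arrows_ne_nil {x w : Obj A} (c : GPath x w) : c.arrows ≠ [] := by
  cases c <;> simp [arrows]

theorem getLast?_arrows {x w : Obj A} (c : GPath x w) :
    c.arrows.getLast? = some ⟨_, _, c.last.2⟩ := by
  induction c with
  | single g p g' => simp [arrows, last]
  | cons g p a ih => simp [arrows, last, List.getLast?_cons, ih]

theorem last_eq {x w : Obj A} {c c' : GPath x w} (h : c.arrows.getLast? = c'.arrows.getLast?) :
    c.last = c'.last := by
  rw [getLast?_arrows, getLast?_arrows, Option.some.injEq, Arrow.mk.injEq] at h
  exact Sigma.ext h.1 (by simpa using h.2)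

theorem paths_comp {x y w : Obj A} (c : GPath x y) (d : GPath y w) :
    (c.comp d).paths = c.paths ++ d.paths := by
  induction c with
  | single g p g' => cases d <;> simp [comp, paths, precomp]
  | cons g p a ih => simp [comp, paths, ih]

theorem arrows_comp {x y w : Obj A} (c : GPath x y) (d : GPath y w) :
    (c.comp d).arrows = c.arrows.dropLast ++ (d.precomp c.last.2).arrows := by
  induction c with
  | single g p g' => simp [comp, arrows, last]
  | cons g p a ih =>
    simp [comp, arrows, last, ih, List.dropLast_cons_of_ne_nil (arrows_ne_nil a)]

theorem head?_comp {x y w : Obj A} (c : GPath x y) (d : GPath y w) :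
    (c.comp d).arrows.head? = c.arrows.head? := by
  cases c <;> simp [comp, arrows]

theorem last_precomp {x x' w : Obj A} (h : x' ⟶ x) (c : GPath x w) :
    (c.precomp h).last = c.last := by
  cases c <;> simp [precomp, last]

theorem last_comp {x y w : Obj A} (c : GPath x y) (d : GPath y w) :
    (c.comp d).last = d.last := by
  induction c with
  | single g p g' => simp [comp, last, last_precomp]
  | cons g p a ih => simp [comp, last, ih]

theorem paths_precomp {x x' w : Obj A} (h : x' ⟶ x) (c : GPath x w) :
    (c.precomp h).paths = c.paths := by
  cases c <;> simp [precomp, paths]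

theorem tail_arrows_precomp {x x' w : Obj A} (h : x' ⟶ x) (c : GPath x w) :
    (c.precomp h).arrows.tail = c.arrows.tail := by
  cases c <;> simp [precomp, arrows]

theorem head?_arrows_precomp {x x' w : Obj A} (h : x' ⟶ x) {c c' : GPath x w}
    (hc : c.arrows.head? = c'.arrows.head?) :
    (c.precomp h).arrows.head? = (c'.precomp h).arrows.head? := by
  cases c <;> cases c' <;>
  · simp only [arrows, List.head?_cons, Option.some.injEq, Arrow.mk.injEq, true_and] at hc
    obtain ⟨rfl, hc⟩ := hc
    cases hc
    simp [precomp, arrows]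

theorem ElementaryHomotopy.precomp {x x' w : Obj A} (h : x' ⟶ x) {c c' : GPath x w}
    (H : ElementaryHomotopy c c') : ElementaryHomotopy (c.precomp h) (c'.precomp h) := by
  obtain ⟨C, B, g, h0, h1, hB, hg, hh, hl⟩ := H
  obtain ⟨a, ha⟩ : ∃ a, (c.precomp h).arrows.head? = some a := by
    cases c <;> simp [GPath.precomp, arrows]
  refine ⟨fun s => (C s).precomp h, B, ContinuousMap.const I a :: g.tail, by simp [h0],
    by simp [h1], fun s => by simp [paths_precomp, hB], fun s => ?_,
    fun s => head?_arrows_precomp h (hh s), fun s => ?_⟩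
  · have e1 := (head?_arrows_precomp h (hh s)).trans ha
    have e2 := tail_arrows_precomp h (C s)
    rw [hg, ← List.map_tail] at e2
    rw [← List.cons_head?_tail e1, e2]
    simp
  · rw [getLast?_arrows, getLast?_arrows, last_precomp, last_precomp, last_eq (hl s)]

theorem exists_const_paths {y w : Obj A} (d : GPath y w) :
    ∃ D : List C(I × I, Obj A), ∀ s : I, d.paths = D.map fun β u => β (s, u) := by
  induction d with
  | single g b g' => exact ⟨[⟨fun p => b p.2, by fun_prop⟩], fun s => rfl⟩
  | cons g b d ih =>
    obtain ⟨D, hD⟩ := ih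
    exact ⟨⟨fun p => b p.2, by fun_prop⟩ :: D, fun s => by simp [paths, ← hD s]⟩

theorem ElementaryHomotopy.comp_right {x y w : Obj A} {c c' : GPath x y}
    (H : ElementaryHomotopy c c') (d : GPath y w) :
    ElementaryHomotopy (c.comp d) (c'.comp d) := by
  obtain ⟨C, B, g, h0, h1, hB, hg, hh, hl⟩ := H
  obtain ⟨D, hD⟩ := exists_const_paths d
  refine ⟨fun s => (C s).comp d, B ++ D,
    g.dropLast ++ (d.precomp c.last.2).arrows.map (ContinuousMap.const I), by simp [h0],
    by simp [h1], fun s => ?_, fun s => ?_, fun s => ?_, fun s => ?_⟩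
  · rw [paths_comp, hB, hD s, List.map_append]
  · rw [arrows_comp, last_eq (hl s), hg, List.map_append, List.map_map, List.map_dropLast]
    congr 1
    simp [Function.comp_def]
  · rw [head?_comp, head?_comp, hh]
  · rw [getLast?_arrows, getLast?_arrows, last_comp, last_comp]

theorem Step.precomp {x x' w : Obj A} (h : x' ⟶ x) {c c' : GPath x w} (H : Step c c') :
    Step (c.precomp h) (c'.precomp h) := by
  cases H with
  | subdivide_last g p q g' => exact .subdivide_last _ _ _ _
  | subdivide g p q c => exact .subdivide _ _ _ _
  | change_last g b g' b' h₀ h₁ H =>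
    simpa [GPath.precomp] using Step.change_last (h ≫ g) b g' b' h₀ h₁ H
  | change g b c b' h₀ h₁ H =>
    simpa [GPath.precomp] using Step.change (h ≫ g) b c b' h₀ h₁ H
  | tail g b H => exact .tail _ _ H
  | homotopy H => exact .homotopy (H.precomp h)

theorem Step.comp_right {x y w : Obj A} {c c' : GPath x y} (H : Step c c') (d : GPath y w) :
    Step (c.comp d) (c'.comp d) := by
  induction H with
  | subdivide_last g p q g' => simpa [comp] using Step.subdivide g p q (d.precomp g')
  | subdivide g p q c => exact .subdivide _ _ _ _
  | change_last g b g' b' h₀ h₁ H =>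
    have := Step.change g b (d.precomp g') b' h₀ h₁ H
    rwa [precomp_precomp] at this
  | change g b c b' h₀ h₁ H =>
    have := Step.change g b (c.comp d) b' h₀ h₁ H
    rwa [precomp_comp] at this
  | tail g b H ih => exact .tail _ _ (ih d)
  | homotopy H => exact .homotopy (H.comp_right d)

theorem Step.comp_left {x y w : Obj A} (d : GPath x y) {c c' : GPath y w} (H : Step c c') :
    Step (d.comp c) (d.comp c') := by
  induction d with
  | single g b g' => exact .tail _ _ (H.precomp g')
  | cons g b d ih => exact .tail _ _ (ih H)

/-- The constant `𝒢`-path at `x` followed by the arrow `g`. -/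
def ofArrow {x y : Obj A} (g : x ⟶ y) : GPath x y := single (𝟙 x) (Path.refl x) g

end GPath

namespace PathClass

/-- The homotopy class `[c]`. -/
def mk {x w : Obj A} (c : GPath x w) : PathClass x w := Quot.mk _ c

/-- Composition `[c][c'] = [c c']` of homotopy classes. -/
def comp {x y w : Obj A} : PathClass x y → PathClass y w → PathClass x w :=
  Quot.map₂ GPath.comp (fun d _ _ h => h.comp_left d) (fun _ _ d h => h.comp_right d)

theorem mk_comp {x y w : Obj A} (c : GPath x y) (d : GPath y w) :
    (mk c).comp (mk d) = mk (c.comp d) := rfl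

theorem sound {x w : Obj A} {c c' : GPath x w} (h : GPath.Step c c') : mk c = mk c' :=
  Quot.sound h

theorem comp_assoc {x y z w : Obj A} (a : PathClass x y) (b : PathClass y z) (c : PathClass z w) :
    (a.comp b).comp c = a.comp (b.comp c) := by
  induction a using Quot.ind
  induction b using Quot.ind
  induction c using Quot.ind
  exact congrArg mk (GPath.comp_assoc _ _ _)

/-- The class of the constant loop. -/
def refl (x : Obj A) : PathClass x x := mk (GPath.ofArrow (𝟙 x))

open GPath

theorem mk_tail {x y z w : Obj A} (g : x ⟶ y) (b : Path y z) {c c' : GPath z w}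
    (h : mk c = mk c') : mk (cons g b c) = mk (cons g b c') := by
  have h' := congrArg (Quot.map (cons g b) (fun _ _ h => Step.tail g b h)) h
  exact h'

theorem mk_single_homotopic {x y z w : Obj A} (g : x ⟶ y) {b b' : Path y z} (g' : z ⟶ w)
    (h : b.Homotopic b') : mk (single g b g') = mk (single g b' g') := by
  obtain ⟨F⟩ := h
  refine sound (.homotopy ⟨fun s => single g (F.eval s) g', [F.toContinuousMap],
    [ContinuousMap.const I ⟨_, _, g⟩, ContinuousMap.const I ⟨_, _, g'⟩], by simp, by simp,
    fun s => ?_, fun s => by simp [arrows], fun s => rfl, fun s => rfl⟩)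
  simp only [paths, List.map_cons, List.map_nil]
  rfl

theorem mk_cons_homotopic {x y z w : Obj A} (g : x ⟶ y) {b b' : Path y z} (c : GPath z w)
    (h : b.Homotopic b') : mk (cons g b c) = mk (cons g b' c) := by
  have := congrArg (fun q => comp q (mk c)) (mk_single_homotopic g (𝟙 z) h)
  simpa [mk_comp, GPath.comp, precomp_id] using this

/-- A constant family of arrows over constant paths. -/
theorem arrowAlong_refl {x y : Obj A} (g : x ⟶ y) :
    ArrowAlong (Path.refl x) (Path.refl y) g g :=
  ⟨ContinuousMap.const I ⟨x, y, g⟩, fun _ => ⟨rfl, rfl⟩, rfl, rfl⟩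

theorem mk_cons_refl {x w : Obj A} (c : GPath x w) :
    mk (cons (𝟙 x) (Path.refl x) c) = mk c := by
  cases c with
  | single g b g' =>
    refine (sound (.change _ _ _ _ g g (arrowAlong_refl g))).trans ?_
    simp only [precomp, Category.id_comp, Groupoid.inv_comp]
    refine (sound (.subdivide_last g (Path.refl _) b g')).symm.trans ?_
    exact mk_single_homotopic g g' ⟨Path.Homotopy.reflTrans b⟩
  | cons g b d =>
    refine (sound (.change _ _ _ _ g g (arrowAlong_refl g))).trans ?_
    simp only [precomp, Category.id_comp, Groupoid.inv_comp]
    refine (sound (.subdivide g (Path.refl _) b d)).symm.trans ?_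
    exact mk_cons_homotopic g d ⟨Path.Homotopy.reflTrans b⟩

theorem refl_comp {x w : Obj A} (a : PathClass x w) : (refl x).comp a = a := by
  induction a using Quot.ind with
  | mk c =>
    change mk (cons _ _ (c.precomp _)) = mk c
    rw [precomp_id, mk_cons_refl]

theorem inv_comp {x w : Obj A} (c : GPath x w) : (mk c.inv).comp (mk c) = refl w := by
  induction c with
  | single g b g' =>
    rw [mk_comp]
    simp only [GPath.inv, GPath.comp, precomp, Groupoid.inv_comp]
    refine (sound (.subdivide_last _ _ _ _)).symm.trans ?_
    refine (mk_single_homotopic _ _ ⟨(Path.Homotopy.reflSymmTrans b).symm⟩).trans ?_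
    refine (sound (.change_last _ _ _ _ g' g' (arrowAlong_refl g'))).trans ?_
    simp only [Groupoid.inv_comp]
    rfl
  | cons g b c ih =>
    simp only [GPath.inv]
    rw [← mk_comp, comp_assoc, ← ih]
    congr 1
    rw [mk_comp]
    simp only [GPath.comp, precomp, Groupoid.inv_comp]
    refine (sound (.subdivide _ _ _ _)).symm.trans ?_
    refine (mk_cons_homotopic _ _ ⟨(Path.Homotopy.reflSymmTrans b).symm⟩).trans ?_
    exact mk_cons_refl c

end PathClass

/-! ### The orbifold fundamental group and the universal covering orbifold -/

/-- The orbifold fundamental group `Γ = π₁^orb(Z, x₀)`: homotopy classes of `𝒢`-loops at `x₀`. -/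
def FundamentalGroup (A : OrbifoldAtlas ι Z m) (x₀ : Obj A) : Type _ := PathClass x₀ x₀

/-- The group law is the composition of loops. -/
instance (x₀ : Obj A) : Group (FundamentalGroup A x₀) :=
  letI : Mul (FundamentalGroup A x₀) := ⟨fun a b => PathClass.comp a b⟩
  letI : One (FundamentalGroup A x₀) := ⟨PathClass.refl x₀⟩
  letI : Inv (FundamentalGroup A x₀) := ⟨fun a => PathClass.mk (Quot.out a).inv⟩
  Group.ofLeftAxioms (fun a b c => PathClass.comp_assoc a b c) (fun a => PathClass.refl_comp a)
    (fun a => by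
      have h := PathClass.inv_comp (Quot.out (a : PathClass x₀ x₀))
      rwa [show PathClass.mk (Quot.out (a : PathClass x₀ x₀)) = a from Quot.out_eq a] at h)

/-- The space `𝒢̂₀` of homotopy classes of `𝒢`-paths starting at `x₀`, with their end points. -/
structure BasedPaths (A : OrbifoldAtlas ι Z m) (x₀ : Obj A) where
  endpt : Obj A
  cls : PathClass x₀ endpt

/-- `[c]` followed by a path `b` lying in the chart of the end point of `c`. -/
def BasedPaths.extend {x₀ : Obj A} (q : BasedPaths A x₀) {w : Obj A} (b : Path q.endpt w) :
    BasedPaths A x₀ :=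
  ⟨w, q.cls.comp (PathClass.mk (.single (𝟙 _) b (𝟙 _)))⟩

/-- `[c]` followed by an arrow `g` issued from the end point of `c`. -/
def BasedPaths.extendArrow {x₀ : Obj A} (q : BasedPaths A x₀) {w : Obj A} (g : q.endpt ⟶ w) :
    BasedPaths A x₀ :=
  ⟨w, q.cls.comp (PathClass.mk (.ofArrow g))⟩

/-- The universal covering orbifold `X` of `Z`: the orbit space of `𝒢̂₀` under the action of the
arrows of `𝒢` at the end point. -/
def UniversalCover (A : OrbifoldAtlas ι Z m) (x₀ : Obj A) : Type _ :=
  Quot fun q q' : BasedPaths A x₀ => ∃ (w : Obj A) (g : q.endpt ⟶ w), q' = q.extendArrow g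

namespace UniversalCover

/-- The quotient map `𝒢̂₀ → X`. -/
def mk {x₀ : Obj A} (q : BasedPaths A x₀) : UniversalCover A x₀ := Quot.mk _ q

/-- The covering projection `p : X → Z`. -/
def proj {x₀ : Obj A} : UniversalCover A x₀ → Z :=
  Quot.lift (fun q => q.endpt.toBase) (by
    rintro q _ ⟨w, g, rfl⟩
    exact toBase_eq_of_hom g)

/-- `Γ` acts on the left on `X` by composition at the starting point, `γ · [c] = [γ c]`. -/
instance (x₀ : Obj A) : MulAction (FundamentalGroup A x₀) (UniversalCover A x₀) where
  smul γ := Quot.map (fun q => ⟨q.endpt, PathClass.comp γ q.cls⟩) (by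
    rintro q _ ⟨w, g, rfl⟩
    exact ⟨w, g, congrArg (BasedPaths.mk w) (PathClass.comp_assoc γ q.cls _).symm⟩)
  one_smul x := by
    induction x using Quot.ind with
    | mk q =>
      exact congrArg (fun a => mk ⟨q.endpt, a⟩) (PathClass.refl_comp q.cls)
  mul_smul γ γ' x := by
    induction x using Quot.ind with
    | mk q =>
      exact congrArg (fun a => mk ⟨q.endpt, a⟩) (PathClass.comp_assoc γ γ' q.cls)

/-- Smoothness of a function `X → ℂ^r`, read in the orbifold charts of `X`, which are the sheets of
the covering `𝒢̂₀ → 𝒢₀`: near every `q ∈ 𝒢̂₀`, the function is given by a smooth function `φ` of the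
end point. -/
def IsSmooth {x₀ : Obj A} {r : ℕ} (f : UniversalCover A x₀ → Fin r → ℂ) : Prop :=
  ∀ q : BasedPaths A x₀, ∃ (N : Set (Model m)) (φ : Model m → Fin r → ℂ),
    IsOpen N ∧ q.endpt.pt ∈ N ∧ ContDiffOn ℝ ∞ φ N ∧
    ∀ (w : Obj A) (b : Path q.endpt w), (∀ u, (b u).pt ∈ N) → f (mk (q.extend b)) = φ w.pt

end UniversalCover

/-- `C^∞(X, ℂ^r)^Γ`: the smooth functions with `f(γ x) = ρ(γ) f(x)`. -/
def equivariantFunctions {x₀ : Obj A} {r : ℕ}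
    (ρ : FundamentalGroup A x₀ →* Matrix.GeneralLinearGroup (Fin r) ℂ) :
    Submodule ℂ (UniversalCover A x₀ → Fin r → ℂ) where
  carrier := {f | UniversalCover.IsSmooth f ∧ ∀ γ x, f (γ • x) = (ρ γ).1.mulVec (f x)}
  zero_mem' := ⟨fun _ => ⟨Set.univ, 0, isOpen_univ, trivial, contDiffOn_const, fun _ _ _ => rfl⟩,
    fun γ x => by simp⟩
  add_mem' := by
    rintro f f' ⟨hf, hf1⟩ ⟨hf', hf1'⟩
    refine ⟨fun q => ?_, fun γ x => by simp [hf1, hf1', Matrix.mulVec_add]⟩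
    obtain ⟨N, φ, hN, hq, hφ, h⟩ := hf q
    obtain ⟨N', φ', hN', hq', hφ', h'⟩ := hf' q
    refine ⟨N ∩ N', φ + φ', hN.inter hN', ⟨hq, hq'⟩,
      (hφ.mono Set.inter_subset_left).add (hφ'.mono Set.inter_subset_right), fun w b hb => ?_⟩
    simp [h w b fun u => (hb u).1, h' w b fun u => (hb u).2]
  smul_mem' := by
    rintro a f ⟨hf, hf1⟩
    refine ⟨fun q => ?_, fun γ x => by simp [hf1, Matrix.mulVec_smul]⟩
    obtain ⟨N, φ, hN, hq, hφ, h⟩ := hf q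
    refine ⟨N, a • φ, hN, hq, contDiffOn_const.smul hφ, fun w b hb => ?_⟩
    simp [h w b hb]

end Paths

/-! ### Orbifold vector bundles -/

section Bundles

variable {ι Z : Type*} [TopologicalSpace Z] {m : ℕ}

/-- A local trivialization over the chart `(Ũ, G_U, π_U)` of a complex orbifold vector bundle of rank
`R` with total space `E` and projection `π`: a finite group `G_U^E` with a surjection onto `G_U` and a
representation on `ℂ^R`, and a map `π_U^E : Ũ × ℂ^R → π⁻¹(U)` over `π_U` inducing a homeomorphism
from the quotient by `G_U^E` onto `π⁻¹(U)`.  As `(Ũ × ℂ^R, G_U^E, π_U^E)` is an orbifold chart of `E`,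
the action of `G_U^E` on `Ũ × ℂ^R` is effective; its action on `Ũ` need not be. -/
structure BundleChart {E : Type*} [TopologicalSpace E] (c : Chart Z m) (π : E → Z) (R : ℕ) where
  GE : Type
  [group : Group GE]
  [finite : Finite GE]
  toG : GE →* c.G
  toG_surjective : Function.Surjective toG
  rep : GE →* Matrix.GeneralLinearGroup (Fin R) ℂ
  effective : ∀ g, (∀ x ∈ c.dom, ∀ v, c.act (toG g) x = x ∧ (rep g).1.mulVec v = v) → g = 1
  proj : Model m × (Fin R → ℂ) → E
  proj_continuousOn : ContinuousOn proj (c.dom ×ˢ Set.univ)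
  proj_isOpen : ∀ W ⊆ c.dom ×ˢ Set.univ, IsOpen W → IsOpen (proj '' W)
  proj_image : proj '' (c.dom ×ˢ Set.univ) = π ⁻¹' c.image
  proj_eq_iff : ∀ x ∈ c.dom, ∀ y ∈ c.dom, ∀ v w, proj (x, v) = proj (y, w) ↔
    ∃ g, c.act (toG g) x = y ∧ (rep g).1.mulVec v = w
  base_proj : ∀ x ∈ c.dom, ∀ v, π (proj (x, v)) = c.proj x

attribute [instance] BundleChart.group BundleChart.finite

/-- `(x, v) ↦ (φ(x), g(x) v)` is an embedding of the bundle chart `b` into `b'`, where `φ` is an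
embedding of orbifold charts and `g` is smooth. -/
structure IsBundleEmbedding {E : Type*} [TopologicalSpace E] {c c' : Chart Z m} {π : E → Z} {R : ℕ}
    (b : BundleChart c π R) (b' : BundleChart c' π R) (φ : Model m → Model m)
    (g : Model m → Matrix.GeneralLinearGroup (Fin R) ℂ) : Prop where
  isChartEmbedding : IsChartEmbedding c c' φ
  smooth : ∀ k l, ContDiffOn ℝ ∞ (fun x => (g x).1 k l) c.dom
  proj_map : ∀ x ∈ c.dom, ∀ v, b'.proj (φ x, (g x).1.mulVec v) = b.proj (x, v)

/-- A complex orbifold vector bundle of rank `R` (proper or not) with total space `E` over the space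
`Z` with orbifold atlas `A`, where `A` is one of the atlases which trivialize the bundle. -/
structure OrbifoldVectorBundle (A : OrbifoldAtlas ι Z m) (E : Type*) [TopologicalSpace E]
    (R : ℕ) where
  π : E → Z
  chart : ∀ i, BundleChart (A.chart i) π R
  compatible : ∀ i j, ∀ z ∈ (A.chart i).image ∩ (A.chart j).image,
    ∃ (c : Chart Z m) (b : BundleChart c π R) (φ ψ : Model m → Model m)
      (g h : Model m → Matrix.GeneralLinearGroup (Fin R) ℂ),
      z ∈ c.image ∧ c.image ⊆ (A.chart i).image ∩ (A.chart j).image ∧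
      SimplyConnectedSpace c.dom ∧
      IsBundleEmbedding b (chart i) φ g ∧ IsBundleEmbedding b (chart j) ψ h

namespace OrbifoldVectorBundle

variable {A : OrbifoldAtlas ι Z m} {E : Type*} [TopologicalSpace E] {R : ℕ}

/-- The bundle is flat: the transition matrices can be chosen constant. -/
def IsFlat (F : OrbifoldVectorBundle A E R) : Prop :=
  ∀ i j, ∀ z ∈ (A.chart i).image ∩ (A.chart j).image,
    ∃ (c : Chart Z m) (b : BundleChart c F.π R) (φ ψ : Model m → Model m)
      (g h : Matrix.GeneralLinearGroup (Fin R) ℂ),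
      z ∈ c.image ∧ c.image ⊆ (A.chart i).image ∩ (A.chart j).image ∧
      SimplyConnectedSpace c.dom ∧
      IsBundleEmbedding b (F.chart i) φ (fun _ => g) ∧
      IsBundleEmbedding b (F.chart j) ψ (fun _ => h)

/-- The point of `E` with coordinates `v` over the object `x ∈ 𝒢₀`. -/
def point (F : OrbifoldVectorBundle A E R) (x : Obj A) (v : Fin R → ℂ) : E :=
  (F.chart x.idx).proj (x.pt, v)

/-- The fibre over the chart `i` of the proper subbundle `F^pr`: the vectors fixed by
`ker (G_U^F → G_U)`. -/
def properFiber (F : OrbifoldVectorBundle A E R) (i : ι) : Submodule ℂ (Fin R → ℂ) where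
  carrier := {v | ∀ g ∈ (F.chart i).toG.ker, ((F.chart i).rep g).1.mulVec v = v}
  zero_mem' := fun g _ => by simp
  add_mem' := fun hv hw g hg => by rw [Matrix.mulVec_add, hv g hg, hw g hg]
  smul_mem' := fun a v hv g hg => by rw [Matrix.mulVec_smul, hv g hg]

/-- `ξ` gives the lifts `x ↦ (x, ξ(x))` of `s : Z → E` in the charts of the atlas; the lifts are smooth
and invariant under `G_U^F`. -/
structure IsLift (F : OrbifoldVectorBundle A E R) (s : Z → E) (ξ : ∀ i, (A.chart i).dom → Fin R → ℂ) :
    Prop where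
  smooth : ∀ i, ∃ τ : Model m → Fin R → ℂ, ContDiffOn ℝ ∞ τ (A.chart i).dom ∧
    ∀ x : (A.chart i).dom, τ x = ξ i x
  proj_lift : ∀ i (x : (A.chart i).dom), s ((A.chart i).proj x) = (F.chart i).proj (x, ξ i x)
  invariant : ∀ i (g : (F.chart i).GE) (x : (A.chart i).dom),
    ξ i ⟨(A.chart i).act ((F.chart i).toG g) x, (A.chart i).act_mem _ _ x.2⟩ =
      ((F.chart i).rep g).1.mulVec (ξ i x)

/-- The space `C^∞(Z, F)` of smooth sections: maps `s : Z → E` with `π ∘ s = id` which have smooth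
lifts in the charts, invariant under the groups `G_U^F`. -/
def SmoothSection (F : OrbifoldVectorBundle A E R) : Type _ :=
  {s : Z → E // (∀ z, F.π (s z) = z) ∧ ∃ ξ, F.IsLift s ξ}

/-! #### The vector space structure of `C^∞(Z, F)` (addition of lifts) -/

/-- Any two charts at a point of `Z` are related by a linear map of the fibres. -/
theorem exists_transition (F : OrbifoldVectorBundle A E R) {i j : ι} {x y : Model m}
    (hx : x ∈ (A.chart i).dom) (hy : y ∈ (A.chart j).dom)
    (h : (A.chart i).proj x = (A.chart j).proj y) :
    ∃ L : Matrix (Fin R) (Fin R) ℂ,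
      ∀ v, (F.chart j).proj (y, L.mulVec v) = (F.chart i).proj (x, v) := by
  obtain ⟨c, b, φ, ψ, g, g', hz, -, -, h1, h2⟩ := F.compatible i j ((A.chart i).proj x)
    ⟨⟨x, hx, rfl⟩, ⟨y, hy, h.symm⟩⟩
  obtain ⟨w, hw, hwz⟩ := hz
  have hφ := h1.isChartEmbedding.mapsTo hw
  have hψ := h2.isChartEmbedding.mapsTo hw
  have e1 : (A.chart i).proj x = (A.chart i).proj (φ w) := by
    rw [h1.isChartEmbedding.proj_map w hw, hwz]
  have e2 : (A.chart j).proj (ψ w) = (A.chart j).proj y := by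
    rw [h2.isChartEmbedding.proj_map w hw, hwz, h]
  obtain ⟨a, ha⟩ := ((A.chart i).proj_eq_iff x hx _ hφ).1 e1
  obtain ⟨d, hd⟩ := ((A.chart j).proj_eq_iff _ hψ y hy).1 e2
  obtain ⟨a, rfl⟩ := (F.chart i).toG_surjective a
  obtain ⟨d, rfl⟩ := (F.chart j).toG_surjective d
  refine ⟨((F.chart j).rep d * g' w * (g w)⁻¹ * (F.chart i).rep a).1, fun v => ?_⟩
  have s1 : (F.chart i).proj (x, v) = (F.chart i).proj (φ w, ((F.chart i).rep a).1.mulVec v) :=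
    ((F.chart i).proj_eq_iff x hx _ hφ _ _).2 ⟨a, ha, rfl⟩
  have s2 := h1.proj_map w hw (((g w)⁻¹ * (F.chart i).rep a).1.mulVec v)
  have s3 := h2.proj_map w hw (((g w)⁻¹ * (F.chart i).rep a).1.mulVec v)
  rw [Matrix.mulVec_mulVec, ← Units.val_mul] at s2 s3
  rw [mul_inv_cancel_left] at s2
  rw [s1, s2, ← s3]
  refine (((F.chart j).proj_eq_iff _ hψ y hy _ _).2 ⟨d, hd, ?_⟩).symm
  rw [Matrix.mulVec_mulVec, ← Units.val_mul]
  simp only [mul_assoc]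

theorem eq_of_proj_eq (F : OrbifoldVectorBundle A E R) {s : Z → E}
    {ξ : ∀ i, (A.chart i).dom → Fin R → ℂ} (hξ : F.IsLift s ξ) {i : ι} (x : (A.chart i).dom)
    {v : Fin R → ℂ} (h : (F.chart i).proj (x, ξ i x) = (F.chart i).proj (x, v)) : ξ i x = v := by
  obtain ⟨g, hg, hv⟩ := ((F.chart i).proj_eq_iff x x.2 x x.2 _ _).1 h
  rw [← hv, ← hξ.invariant i g x]
  congr 1
  exact Subtype.ext hg.symm

theorem IsLift.unique {F : OrbifoldVectorBundle A E R} {s : Z → E}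
    {ξ ξ' : ∀ i, (A.chart i).dom → Fin R → ℂ} (hξ : F.IsLift s ξ) (hξ' : F.IsLift s ξ') :
    ξ = ξ' := by
  funext i x
  exact F.eq_of_proj_eq hξ x (by rw [← hξ.proj_lift, ← hξ'.proj_lift])

theorem IsLift.transition {F : OrbifoldVectorBundle A E R} {s : Z → E}
    {ξ : ∀ i, (A.chart i).dom → Fin R → ℂ} (hξ : F.IsLift s ξ) {i j : ι} (x : (A.chart i).dom)
    (y : (A.chart j).dom) (h : (A.chart i).proj x = (A.chart j).proj y)
    {L : Matrix (Fin R) (Fin R) ℂ}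
    (hL : ∀ v, (F.chart j).proj (y, L.mulVec v) = (F.chart i).proj (x, v)) :
    ξ j y = L.mulVec (ξ i x) :=
  F.eq_of_proj_eq hξ y (by rw [hL, ← hξ.proj_lift, ← hξ.proj_lift, h])

/-- A family which is related by the linear transition maps between the charts comes from a map
`Z → E`. -/
theorem exists_of_transition (F : OrbifoldVectorBundle A E R)
    (ξ : ∀ i, (A.chart i).dom → Fin R → ℂ)
    (hξ : ∀ i j (x : (A.chart i).dom) (y : (A.chart j).dom) (L : Matrix (Fin R) (Fin R) ℂ),
      (A.chart i).proj x = (A.chart j).proj y →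
      (∀ v, (F.chart j).proj (y, L.mulVec v) = (F.chart i).proj (x, v)) →
      ξ j y = L.mulVec (ξ i x)) :
    ∃ s : Z → E, (∀ z, F.π (s z) = z) ∧
      ∀ i (x : (A.chart i).dom), s ((A.chart i).proj x) = (F.chart i).proj (x, ξ i x) := by
  choose k hk using A.cover
  choose p hp hpz using hk
  refine ⟨fun z => (F.chart (k z)).proj (p z, ξ (k z) ⟨p z, hp z⟩), fun z => ?_, fun i x => ?_⟩
  · rw [(F.chart (k z)).base_proj _ (hp z), hpz]
  · have h := hpz ((A.chart i).proj x)
    obtain ⟨L, hL⟩ := F.exists_transition (hp _) x.2 h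
    rw [hξ _ i ⟨_, hp _⟩ x L h hL, hL]

/-- The families of invariant lifts of smooth sections form a vector space. -/
def lifts (F : OrbifoldVectorBundle A E R) :
    Submodule ℂ (∀ i, (A.chart i).dom → Fin R → ℂ) where
  carrier := {ξ | ∃ s, (∀ z, F.π (s z) = z) ∧ F.IsLift s ξ}
  zero_mem' := by
    obtain ⟨s, h, h'⟩ := F.exists_of_transition 0 (fun i j x y L _ _ => by simp)
    exact ⟨s, h, fun i => ⟨0, contDiffOn_const, fun x => rfl⟩, h', fun i g x => by simp⟩
  add_mem' := by
    rintro ξ τ ⟨s, hs, hξ⟩ ⟨t, ht, hτ⟩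
    obtain ⟨u, h, h'⟩ := F.exists_of_transition (ξ + τ) (fun i j x y L hxy hL => by
      simp [hξ.transition x y hxy hL, hτ.transition x y hxy hL, Matrix.mulVec_add])
    refine ⟨u, h, fun i => ?_, h', fun i g x => by
      simp [hξ.invariant, hτ.invariant, Matrix.mulVec_add]⟩
    obtain ⟨a, ha, ha'⟩ := hξ.smooth i
    obtain ⟨b, hb, hb'⟩ := hτ.smooth i
    exact ⟨a + b, ha.add hb, fun x => by simp [ha', hb']⟩
  smul_mem' := by
    rintro a ξ ⟨s, hs, hξ⟩
    obtain ⟨u, h, h'⟩ := F.exists_of_transition (a • ξ) (fun i j x y L hxy hL => by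
      simp [hξ.transition x y hxy hL, Matrix.mulVec_smul])
    refine ⟨u, h, fun i => ?_, h', fun i g x => by
      simp [hξ.invariant, Matrix.mulVec_smul]⟩
    obtain ⟨b, hb, hb'⟩ := hξ.smooth i
    exact ⟨a • b, contDiffOn_const.smul hb, fun x => by simp [hb']⟩

/-- The invariant lifts of a smooth section. -/
def SmoothSection.lift {F : OrbifoldVectorBundle A E R} (s : F.SmoothSection) :
    ∀ i, (A.chart i).dom → Fin R → ℂ := s.2.2.choose

theorem SmoothSection.isLift {F : OrbifoldVectorBundle A E R} (s : F.SmoothSection) :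
    F.IsLift s.1 s.lift := s.2.2.choose_spec

theorem SmoothSection.lift_bijective (F : OrbifoldVectorBundle A E R) :
    Function.Bijective fun s : F.SmoothSection =>
      (⟨s.lift, s.1, s.2.1, s.isLift⟩ : F.lifts) := by
  refine ⟨fun s t h => Subtype.ext (funext fun z => ?_), fun ⟨ξ, s, hs, hξ⟩ => ?_⟩
  · obtain ⟨i, x, hx, rfl⟩ := A.cover z
    have h' : s.lift = t.lift := congrArg Subtype.val h
    rw [s.isLift.proj_lift i ⟨x, hx⟩, t.isLift.proj_lift i ⟨x, hx⟩, h']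
  · exact ⟨⟨s, hs, ξ, hξ⟩, Subtype.ext ((SmoothSection.isLift ⟨s, hs, ξ, hξ⟩).unique hξ)⟩

/-- A smooth section and the family of its invariant lifts determine each other. -/
def sectionEquivLifts (F : OrbifoldVectorBundle A E R) : F.SmoothSection ≃ F.lifts :=
  Equiv.ofBijective _ (SmoothSection.lift_bijective F)

instance (F : OrbifoldVectorBundle A E R) : AddCommGroup F.SmoothSection :=
  F.sectionEquivLifts.addCommGroup

/-- The complex vector space structure of `C^∞(Z, F)`: sections are added by adding their lifts. -/
instance (F : OrbifoldVectorBundle A E R) : Module ℂ F.SmoothSection :=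
  F.sectionEquivLifts.module ℂ

end OrbifoldVectorBundle

end Bundles

end Orbifold

end

/-! Flatness gives constant transition matrices along germs of coordinate transformations. A germ
does not determine its matrix: matrices can differ by the action of `ker (G_U^F → G_U)`. On the
fixed vectors `V_U` this ambiguity disappears, because points with trivial isotropy are dense, and
over such a point two vectors with the same image in the total space differ by an element of the
kernel. Every arrow of `𝒢` therefore acts on the fibres `V_U`, functorially (`transport_comp`) and
locally constantly in the germ topology (`isLocallyConstant_transport`).

Coordinate transformations are only required to commute with the projections to `Z`. Their
comparison with the embeddings supplied by flatness rests on the rigidity result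
`Chart.eventually_eq_act`: two local diffeomorphisms into a chart over the same map to `Z` differ
locally by one group element.

The product of the transports along a `𝒢`-path is invariant under homotopy (`holonomy_eq_of_step`),
and paths inside a chart contribute nothing. With `J` a basis of the fibre `V` at `x₀`, the map is
`Φ([q], v) = [end of q, hol(q) J v]`, and `ρ(γ)` is the matrix of the holonomy of `γ⁻¹` on `V`.

An invariant lift takes its values in `V_U`, since the kernel acts trivially on the chart. A section
with lifts `ξ` thus corresponds to the unique `f` with `hol(q) J f([q]) = ξ(end of q)`. Conversely,
equivariance of `f` makes the left side depend only on the end point of `q`, and connectedness of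
`Z` ensures that every object is an end point.

Holonomies are kept as endomorphisms of `ℂ^R`, by composing with chosen projections onto `V_U`;
these projections play the role of identities. -/

namespace Orbifold

/-! ### Rigidity of orbifold charts -/

/-- Finitely many relatively closed sets covering a nonempty open subset of a Baire space: one of
them has interior points. -/
theorem exists_interior_of_finite_cover {X : Type*} [TopologicalSpace X] [BaireSpace X]
    {κ : Type*} [Finite κ] {W : Set X} (hW : IsOpen W) (S : κ → Set X)
    (hS : ∀ k, IsOpen (W \ S k)) (hc : W ⊆ ⋃ k, S k) {V : Set X} (hV : IsOpen V)
    (hVW : (V ∩ W).Nonempty) :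
    ∃ k, ∃ U ⊆ V ∩ W ∩ S k, IsOpen U ∧ U.Nonempty := by
  have hd : Dense (⋃ k, interior ((W \ S k)ᶜ)) ∨ IsEmpty κ := by
    cases isEmpty_or_nonempty κ with
    | inl h => exact .inr h
    | inr h =>
      -- The closed sets `(W \ S k)ᶜ` contain everything outside `W`, so they cover the whole Baire
      -- space once some index exists.
      refine .inl (dense_iUnion_interior_of_closed (fun k => (hS k).isClosed_compl) ?_)
      refine Set.eq_univ_of_forall fun x => ?_
      by_cases hx : x ∈ W
      · obtain ⟨k, hk⟩ := Set.mem_iUnion.1 (hc hx)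
        exact Set.mem_iUnion.2 ⟨k, fun h => h.2 hk⟩
      · exact Set.mem_iUnion.2 ⟨Classical.arbitrary κ, fun h => hx h.1⟩
  rcases hd with hd | hd
  · obtain ⟨x, hx, hx'⟩ := hd.inter_open_nonempty _ (hV.inter hW) hVW
    obtain ⟨k, hk⟩ := Set.mem_iUnion.1 hx'
    refine ⟨k, V ∩ W ∩ interior ((W \ S k)ᶜ), fun y hy => ⟨hy.1, ?_⟩,
      (hV.inter hW).inter isOpen_interior, ⟨x, hx, hk⟩⟩
    by_contra h
    exact interior_subset hy.2 ⟨hy.1.2, h⟩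
  · obtain ⟨x, hx⟩ := hVW
    obtain ⟨k, -⟩ := Set.mem_iUnion.1 (hc hx.2)
    exact (hd.false k).elim

/-- A map with invertible derivative is injective near the point. -/
theorem eventually_eq_of_comp_eq {E F : Type*} [NormedAddCommGroup E] [NormedSpace ℝ E]
    [CompleteSpace E] [NormedAddCommGroup F] [NormedSpace ℝ F] {φ : E → F} {p : E} (L : E ≃L[ℝ] F)
    (hφ : HasStrictFDerivAt φ (L : E →L[ℝ] F) p) {X : Type*} {l : Filter X} {f g : X → E}
    (hf : Filter.Tendsto f l (𝓝 p)) (hg : Filter.Tendsto g l (𝓝 p))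
    (h : ∀ᶠ x in l, φ (f x) = φ (g x)) : f =ᶠ[l] g := by
  have hi := hφ.eventually_left_inverse
  filter_upwards [h, hf.eventually hi, hg.eventually hi] with x h1 h2 h3
  rw [← h2, ← h3, h1]

namespace Chart

variable {Z : Type*} [TopologicalSpace Z] {m : ℕ} (c : Chart Z m)

theorem contDiffAt_act (g : c.G) {x : Model m} (hx : x ∈ c.dom) : ContDiffAt ℝ ∞ (c.act g) x :=
  (c.act_smooth g).contDiffAt (c.isOpen_dom.mem_nhds hx)

theorem differentiableAt_act (g : c.G) {x : Model m} (hx : x ∈ c.dom) :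
    DifferentiableAt ℝ (c.act g) x :=
  (c.contDiffAt_act g hx).differentiableAt (by simp)

theorem continuousAt_act (g : c.G) {x : Model m} (hx : x ∈ c.dom) : ContinuousAt (c.act g) x :=
  (c.contDiffAt_act g hx).continuousAt

theorem act_inv_act (g : c.G) {x : Model m} (hx : x ∈ c.dom) : c.act g⁻¹ (c.act g x) = x := by
  rw [← c.act_mul _ _ x hx, inv_mul_cancel, c.act_one x hx]

theorem act_act_inv (g : c.G) {x : Model m} (hx : x ∈ c.dom) : c.act g (c.act g⁻¹ x) = x := by
  simpa using c.act_inv_act g⁻¹ hx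

theorem proj_act (g : c.G) {x : Model m} (hx : x ∈ c.dom) : c.proj (c.act g x) = c.proj x :=
  ((c.proj_eq_iff x hx _ (c.act_mem g x hx)).2 ⟨g, rfl⟩).symm

theorem fderiv_act_mul (g h : c.G) {x : Model m} (hx : x ∈ c.dom) :
    fderiv ℝ (c.act (g * h)) x = (fderiv ℝ (c.act g) (c.act h x)).comp (fderiv ℝ (c.act h) x) := by
  rw [← fderiv_comp x (c.differentiableAt_act g (c.act_mem h x hx)) (c.differentiableAt_act h hx)]
  refine Filter.EventuallyEq.fderiv_eq ?_
  filter_upwards [c.isOpen_dom.mem_nhds hx] with y hy using c.act_mul g h y hy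

theorem fderiv_act_one {x : Model m} (hx : x ∈ c.dom) :
    fderiv ℝ (c.act 1) x = ContinuousLinearMap.id ℝ _ := by
  rw [← fderiv_id (𝕜 := ℝ) (x := x)]
  refine Filter.EventuallyEq.fderiv_eq ?_
  filter_upwards [c.isOpen_dom.mem_nhds hx] with y hy using c.act_one y hy

theorem act_pow_fix {h : c.G} {p : Model m} (hp : p ∈ c.dom) (hfix : c.act h p = p)
    (hd : fderiv ℝ (c.act h) p = ContinuousLinearMap.id ℝ _) (k : ℕ) :
    c.act (h ^ k) p = p ∧ fderiv ℝ (c.act (h ^ k)) p = ContinuousLinearMap.id ℝ _ := by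
  induction k with
  | zero => simpa using ⟨c.act_one p hp, c.fderiv_act_one hp⟩
  | succ k ih =>
    rw [pow_succ, c.fderiv_act_mul _ _ hp, c.act_mul _ _ _ hp, hfix, ih.1, ih.2, hd]
    exact ⟨rfl, rfl⟩

/-- Local form of the linearization argument: an element of the finite group `G_U` which fixes a
point to first order is the identity near that point. -/
theorem act_eventuallyEq_id {h : c.G} {p : Model m} (hp : p ∈ c.dom) (hfix : c.act h p = p)
    (hd : fderiv ℝ (c.act h) p = ContinuousLinearMap.id ℝ _) :
    ∀ᶠ x in 𝓝 p, c.act h x = x := by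
  set n := orderOf h with hn
  have hn0 : (n : ℝ) ≠ 0 := by
    exact_mod_cast (orderOf_pos h).ne'
  -- The sum of the powers of `h` satisfies `φ ∘ h = φ`. Its derivative at `p` is `n` times the
  -- identity, as each power fixes `p` to first order. Local injectivity of `φ` then forces `h = id`
  -- near `p`.
  set φ : Model m → Model m := fun x => ∑ k ∈ Finset.range n, c.act (h ^ k) x with hφ
  have hstrict : HasStrictFDerivAt φ
      ((ContinuousLinearEquiv.smulLeft (Units.mk0 (n : ℝ) hn0) :
        Model m ≃L[ℝ] Model m) : Model m →L[ℝ] Model m) p := by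
    have h1 : HasStrictFDerivAt φ
        (∑ k ∈ Finset.range n, ContinuousLinearMap.id ℝ (Model m)) p := by
      refine HasStrictFDerivAt.fun_sum fun k _ => ?_
      have := (c.contDiffAt_act (h ^ k) hp).hasStrictFDerivAt (by simp)
      rwa [(c.act_pow_fix hp hfix hd k).2] at this
    convert h1 using 1
    ext1 v
    simp [Units.smul_def, Nat.cast_smul_eq_nsmul]
  refine eventually_eq_of_comp_eq _ hstrict (f := c.act h) (g := fun x => x) ?_
    Filter.tendsto_id ?_
  · have := (c.continuousAt_act h hp).tendsto
    rwa [hfix] at this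
  · filter_upwards [c.isOpen_dom.mem_nhds hp] with x hx
    have e1 : φ (c.act h x) = ∑ k ∈ Finset.range n, c.act (h ^ (k + 1)) x := by
      refine Finset.sum_congr rfl fun k _ => ?_
      rw [pow_succ, c.act_mul _ _ _ hx]
    -- Splitting off the first or the last term of the sum over `0, …, n` gives equal remainders,
    -- because `h ^ n = 1 = h ^ 0`.
    have e2 := Finset.sum_range_succ (fun k => c.act (h ^ k) x) n
    rw [Finset.sum_range_succ', hn, pow_orderOf_eq_one, pow_zero] at e2
    rw [e1]
    exact add_right_cancel e2

/-- An element of `G_U` which fixes a point to first order is trivial. -/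
theorem eq_one_of_fderiv {h : c.G} {p : Model m} (hp : p ∈ c.dom) (hfix : c.act h p = p)
    (hd : fderiv ℝ (c.act h) p = ContinuousLinearMap.id ℝ _) : h = 1 := by
  -- A connectedness argument: at a limit point of `u` the value and the derivative of `h` pass to
  -- the limit, so the local statement applies there again.
  set u : Set (Model m) := {x | ∀ᶠ y in 𝓝 x, c.act h y = y} with hu
  have huo : IsOpen u := isOpen_setOfPred_eventually_nhds
  have hsub : c.dom ⊆ u := by
    refine c.isConnected_dom.isPreconnected.subset_of_closure_inter_subset huo
      ⟨p, hp, c.act_eventuallyEq_id hp hfix hd⟩ ?_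
    rintro x ⟨hx, hxd⟩
    have hfd : ∀ y ∈ u, fderiv ℝ (c.act h) y = ContinuousLinearMap.id ℝ _ := fun y hy => by
      rw [← fderiv_id (𝕜 := ℝ) (x := y)]
      exact Filter.EventuallyEq.fderiv_eq hy
    have hxc : x ∈ closure u := hx
    rw [mem_closure_iff_nhdsWithin_neBot] at hxc
    refine c.act_eventuallyEq_id hxd ?_ ?_
    · refine tendsto_nhds_unique_of_eventuallyEq (l := 𝓝[u] x)
        ((c.continuousAt_act h hxd).tendsto.mono_left nhdsWithin_le_nhds)
        (Filter.tendsto_id.mono_left nhdsWithin_le_nhds) ?_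
      filter_upwards [self_mem_nhdsWithin] with y hy using hy.self_of_nhds
    · have hc : ContinuousAt (fderiv ℝ (c.act h)) x :=
        (c.contDiffAt_act h hxd).continuousAt_fderiv (by simp)
      refine tendsto_nhds_unique_of_eventuallyEq (l := 𝓝[u] x)
        (hc.tendsto.mono_left nhdsWithin_le_nhds) tendsto_const_nhds ?_
      filter_upwards [self_mem_nhdsWithin] with y hy using hfd y hy
  exact c.act_effective h fun x hx => (hsub hx).self_of_nhds

theorem eq_one_of_eventually {h : c.G} {p : Model m} (hp : p ∈ c.dom)
    (hh : ∀ᶠ x in 𝓝 p, c.act h x = x) : h = 1 :=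
  c.eq_one_of_fderiv hp hh.self_of_nhds (by
    rw [← fderiv_id (𝕜 := ℝ) (x := p)]
    exact Filter.EventuallyEq.fderiv_eq hh)

/-- Points with trivial isotropy are dense. -/
theorem exists_free {V : Set (Model m)} (hV : IsOpen V) (hne : (V ∩ c.dom).Nonempty) :
    ∃ x ∈ V ∩ c.dom, ∀ g, c.act g x = x → g = 1 := by
  by_contra! hcon
  -- Otherwise the fixed sets of the finitely many nontrivial elements cover `V ∩ dom`, and by Baire
  -- one of them has interior.
  obtain ⟨⟨g, hg⟩, U, hU, hUo, y, hy⟩ := exists_interior_of_finite_cover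
    (hV.inter c.isOpen_dom)
    (fun g : {g : c.G // g ≠ 1} => {x | c.act g x = x}) (fun g => by
      rw [isOpen_iff_mem_nhds]
      rintro x ⟨hx, hx'⟩
      have h2 := ((c.continuousAt_act g.1 hx.2).tendsto.prodMk_nhds
        Filter.tendsto_id).eventually (isClosed_diagonal.isOpen_compl.mem_nhds hx')
      filter_upwards [(hV.inter c.isOpen_dom).mem_nhds hx, h2] with y hy hy'
      exact ⟨hy, hy'⟩)
    (fun x hx => by
      obtain ⟨g, h, h'⟩ := hcon x hx
      exact Set.mem_iUnion.2 ⟨⟨g, h'⟩, h⟩)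
    isOpen_univ (by simpa using hne)
  refine hg (c.eq_one_of_eventually (hU hy).1.2.2 ?_)
  filter_upwards [hUo.mem_nhds hy] with x hx using (hU hx).2

/-- Two smooth maps into an orbifold chart, local diffeomorphisms at each point, with the same
projection to the base differ locally by an element of the group. -/
theorem eventually_eq_act {W : Set (Model m)} (hW : IsOpen W) {f f' : Model m → Model m}
    (hf : ContDiffOn ℝ ∞ f W) (hf' : ContDiffOn ℝ ∞ f' W) (hfd : Set.MapsTo f W c.dom)
    (hfd' : Set.MapsTo f' W c.dom) (hinj : ∀ x ∈ W, Function.Injective (fderiv ℝ f x))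
    (hproj : ∀ x ∈ W, c.proj (f x) = c.proj (f' x)) {p : Model m} (hp : p ∈ W) :
    ∃ g, ∀ᶠ x in 𝓝 p, f' x = c.act g (f x) := by
  have hca : ∀ x ∈ W, ContDiffAt ℝ ∞ f x := fun x hx => hf.contDiffAt (hW.mem_nhds hx)
  have hca' : ∀ x ∈ W, ContDiffAt ℝ ∞ f' x := fun x hx => hf'.contDiffAt (hW.mem_nhds hx)
  have hcg : ∀ g, ∀ x ∈ W, ContDiffAt ℝ ∞ (fun y => c.act g (f y)) x := fun g x hx =>
    (c.contDiffAt_act g (hfd hx)).comp x (hca x hx)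
  -- Inside `W`, the closures of the sets `U g` are shown to be pairwise disjoint and to cover. As
  -- there are finitely many, only one of them meets a small neighbourhood of `p`.
  set U : c.G → Set (Model m) := fun g => {x | ∀ᶠ y in 𝓝 x, f' y = c.act g (f y)} with hU
  have hUo : ∀ g, IsOpen (U g) := fun g => isOpen_setOfPred_eventually_nhds
  have key : ∀ g, ∀ x ∈ W, x ∈ closure (U g) → f' x = c.act g (f x) ∧
      fderiv ℝ f' x = (fderiv ℝ (c.act g) (f x)).comp (fderiv ℝ f x) := by
    intro g x hx hxc
    rw [mem_closure_iff_nhdsWithin_neBot] at hxc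
    constructor
    · refine tendsto_nhds_unique_of_eventuallyEq (l := 𝓝[U g] x)
        ((hca' x hx).continuousAt.tendsto.mono_left nhdsWithin_le_nhds)
        ((hcg g x hx).continuousAt.tendsto.mono_left nhdsWithin_le_nhds) ?_
      filter_upwards [self_mem_nhdsWithin] with y hy using hy.self_of_nhds
    · rw [← fderiv_comp x (c.differentiableAt_act g (hfd hx)) ((hca x hx).differentiableAt (by simp))]
      refine tendsto_nhds_unique_of_eventuallyEq (l := 𝓝[U g] x)
        (((hca' x hx).continuousAt_fderiv (by simp)).tendsto.mono_left nhdsWithin_le_nhds)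
        (((hcg g x hx).continuousAt_fderiv (by simp)).tendsto.mono_left nhdsWithin_le_nhds) ?_
      filter_upwards [self_mem_nhdsWithin] with y hy using Filter.EventuallyEq.fderiv_eq hy
  -- At a common limit point `g⁻¹ g'` fixes `f x` to first order, because the derivative of `f` at
  -- `x` is onto.
  have uniq : ∀ g g', ∀ x ∈ W, x ∈ closure (U g) → x ∈ closure (U g') → g = g' := by
    intro g g' x hx hg hg'
    obtain ⟨a, b⟩ := key g x hx hg
    obtain ⟨a', b'⟩ := key g' x hx hg'
    have hsurj : Function.Surjective (fderiv ℝ f x) :=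
      (LinearMap.injective_iff_surjective (f := (fderiv ℝ f x : Model m →ₗ[ℝ] Model m))).1 (hinj x hx)
    have hfx := hfd hx
    have e : fderiv ℝ (c.act g) (f x) = fderiv ℝ (c.act g') (f x) := by
      ext1 v
      obtain ⟨w, rfl⟩ := hsurj v
      exact DFunLike.congr_fun (b.symm.trans b') w
    have e2 : c.act g (f x) = c.act g' (f x) := a.symm.trans a'
    have : g⁻¹ * g' = 1 := by
      refine c.eq_one_of_fderiv hfx ?_ ?_
      · rw [c.act_mul _ _ _ hfx, ← e2, c.act_inv_act _ hfx]
      · rw [c.fderiv_act_mul _ _ hfx, ← e2, ← e, ← c.fderiv_act_mul _ _ hfx, inv_mul_cancel,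
          c.fderiv_act_one hfx]
    exact (inv_mul_eq_one.1 this)
  -- Pointwise, `f'` and `f` lie in the same orbit; Baire upgrades this to equality `f' = g f` on an
  -- open set inside any given neighbourhood.
  have cover : ∀ x ∈ W, x ∈ ⋃ g, closure (U g) := by
    intro x hx
    rw [← closure_iUnion_of_finite, mem_closure_iff]
    intro V hV hxV
    obtain ⟨g, O, hO, hOo, y, hy⟩ := exists_interior_of_finite_cover hW
      (fun g : c.G => {x | f' x = c.act g (f x)}) (fun g => by
        rw [isOpen_iff_mem_nhds]
        rintro x ⟨hx, hx'⟩
        have h2 := ((hca' x hx).continuousAt.tendsto.prodMk_nhds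
          (hcg g x hx).continuousAt.tendsto).eventually
            (isClosed_diagonal.isOpen_compl.mem_nhds hx')
        filter_upwards [hW.mem_nhds hx, h2] with y hy hy'
        exact ⟨hy, hy'⟩)
      (fun x hx => by
        obtain ⟨g, hg⟩ := (c.proj_eq_iff _ (hfd hx) _ (hfd' hx)).1 (hproj x hx)
        exact Set.mem_iUnion.2 ⟨g, hg.symm⟩)
      hV ⟨x, hxV, hx⟩
    refine ⟨y, (hO hy).1.1, Set.mem_iUnion.2 ⟨g, ?_⟩⟩
    filter_upwards [hOo.mem_nhds hy] with z hz using (hO hz).2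
  obtain ⟨g, hg⟩ := Set.mem_iUnion.1 (cover p hp)
  refine ⟨g, ?_⟩
  have hcl : IsClosed (⋃ g' : {g' // g' ≠ g}, closure (U g'.1)) :=
    isClosed_iUnion_of_finite fun _ => isClosed_closure
  have hnot : p ∉ ⋃ g' : {g' // g' ≠ g}, closure (U g'.1) := by
    rintro h
    obtain ⟨g', h⟩ := Set.mem_iUnion.1 h
    exact g'.2 (uniq _ _ p hp h hg)
  filter_upwards [hcl.isOpen_compl.mem_nhds hnot, hW.mem_nhds hp] with x hx hxW
  obtain ⟨g', hg'⟩ := Set.mem_iUnion.1 (cover x hxW)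
  by_cases h : g' = g
  · subst h
    exact (key _ x hxW hg').1
  · exact (hx (Set.mem_iUnion.2 ⟨⟨g', h⟩, hg'⟩)).elim

end Chart

end Orbifold

noncomputable section

namespace Orbifold

/-! ### Coordinate transformations between points over the same point of the base -/

variable {ι Z : Type*} [TopologicalSpace Z] {m : ℕ}

/-- An injective endomorphism of the model space as a continuous linear equivalence. -/
def equivOfInjective (L : Model m →L[ℝ] Model m) (h : Function.Injective L) :
    Model m ≃L[ℝ] Model m :=
  (LinearEquiv.ofInjectiveEndo (L : Model m →ₗ[ℝ] Model m) h).toContinuousLinearEquiv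

theorem coe_equivOfInjective (L : Model m →L[ℝ] Model m) (h : Function.Injective L) :
    (equivOfInjective L h : Model m →L[ℝ] Model m) = L := by
  ext1 v
  rfl

namespace IsChartEmbedding

variable {c d : Chart Z m} {φ : Model m → Model m}

theorem hasStrictFDerivAt (h : IsChartEmbedding c d φ) {x : Model m} (hx : x ∈ c.dom) :
    HasStrictFDerivAt φ
      (equivOfInjective (fderiv ℝ φ x) (h.immersion x hx) : Model m →L[ℝ] Model m) x := by
  rw [coe_equivOfInjective]
  exact (h.smooth.contDiffAt (c.isOpen_dom.mem_nhds hx)).hasStrictFDerivAt (by simp)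

theorem map_nhds (h : IsChartEmbedding c d φ) {x : Model m} (hx : x ∈ c.dom) :
    Filter.map φ (𝓝 x) = 𝓝 (φ x) :=
  (h.hasStrictFDerivAt hx).map_nhds_eq_of_equiv

/-- An embedding of charts is a homeomorphism onto an open subset. -/
def toOpenPartialHomeomorph (h : IsChartEmbedding c d φ) :
    OpenPartialHomeomorph (Model m) (Model m) :=
  OpenPartialHomeomorph.ofContinuousOpenRestrict (h.injOn.toPartialEquiv φ c.dom)
    h.smooth.continuousOn
    (by
      refine isOpenMap_iff_nhds_le.2 fun x => ?_
      change 𝓝 (φ x.1) ≤ Filter.map (φ ∘ Subtype.val) (𝓝 x)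
      rw [← Filter.map_map, map_nhds_subtype_coe_eq_nhds x.2 (c.isOpen_dom.mem_nhds x.2),
        h.map_nhds x.2])
    c.isOpen_dom

theorem target_subset (h : IsChartEmbedding c d φ) :
    h.toOpenPartialHomeomorph.target ⊆ d.dom := by
  rintro _ ⟨x, hx, rfl⟩
  exact h.mapsTo hx

theorem contDiffOn_symm (h : IsChartEmbedding c d φ) :
    ContDiffOn ℝ ∞ h.toOpenPartialHomeomorph.symm h.toOpenPartialHomeomorph.target := by
  intro y hy
  have hx := h.toOpenPartialHomeomorph.map_target hy
  refine (OpenPartialHomeomorph.contDiffAt_symm _ hy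
    (h.hasStrictFDerivAt hx).hasFDerivAt ?_).contDiffWithinAt
  exact h.smooth.contDiffAt (c.isOpen_dom.mem_nhds hx)

end IsChartEmbedding

namespace Change

variable {A : OrbifoldAtlas ι Z m}

/-- The coordinate transformation `ψ ∘ φ⁻¹` defined by two embeddings of a common chart. -/
def ofEmbeddings {i j : ι} {c : Chart Z m} {φ ψ : Model m → Model m}
    (hφ : IsChartEmbedding c (A.chart i) φ) (hψ : IsChartEmbedding c (A.chart j) ψ) :
    Change A i j where
  map := hφ.toOpenPartialHomeomorph.symm.trans hψ.toOpenPartialHomeomorph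
  source_subset := fun x hx => by
    rw [OpenPartialHomeomorph.trans_source] at hx
    exact hφ.target_subset hx.1
  target_subset := fun x hx => by
    rw [OpenPartialHomeomorph.trans_target] at hx
    exact hψ.target_subset hx.1
  smooth := by
    rw [OpenPartialHomeomorph.coe_trans, OpenPartialHomeomorph.trans_source]
    exact hψ.smooth.comp (hφ.contDiffOn_symm.mono Set.inter_subset_left) (fun x hx => hx.2)
  smooth_symm := by
    rw [OpenPartialHomeomorph.coe_trans_symm, OpenPartialHomeomorph.trans_target]
    exact hφ.smooth.comp (hψ.contDiffOn_symm.mono Set.inter_subset_left) (fun x hx => hx.2)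
  proj_map := fun x hx => by
    rw [OpenPartialHomeomorph.trans_source] at hx
    have h1 : hφ.toOpenPartialHomeomorph.symm x ∈ c.dom := hx.2
    have h2 : φ (hφ.toOpenPartialHomeomorph.symm x) = x :=
      hφ.toOpenPartialHomeomorph.right_inv hx.1
    change (A.chart j).proj (ψ (hφ.toOpenPartialHomeomorph.symm x)) = _
    rw [hψ.proj_map _ h1, ← hφ.proj_map _ h1, h2]

/-- The coordinate transformation given by an element of `G_U`. -/
def ofAct (A : OrbifoldAtlas ι Z m) (i : ι) (g : (A.chart i).G) : Change A i i where
  map :=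
    { toFun := (A.chart i).act g
      invFun := (A.chart i).act g⁻¹
      source := (A.chart i).dom
      target := (A.chart i).dom
      map_source' := fun x hx => (A.chart i).act_mem g x hx
      map_target' := fun x hx => (A.chart i).act_mem g⁻¹ x hx
      left_inv' := fun _ hx => (A.chart i).act_inv_act g hx
      right_inv' := fun _ hx => (A.chart i).act_act_inv g hx
      open_source := (A.chart i).isOpen_dom
      open_target := (A.chart i).isOpen_dom
      continuousOn_toFun := ((A.chart i).act_smooth g).continuousOn
      continuousOn_invFun := ((A.chart i).act_smooth g⁻¹).continuousOn }
  source_subset := subset_rfl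
  target_subset := subset_rfl
  smooth := (A.chart i).act_smooth g
  smooth_symm := (A.chart i).act_smooth g⁻¹
  proj_map := fun _ hx => (A.chart i).proj_act g hx

/-- The derivative of a coordinate transformation is injective. -/
theorem injective_fderiv {i j : ι} (e : Change A i j) {x : Model m} (hx : x ∈ e.map.source) :
    Function.Injective (fderiv ℝ e.map x) := by
  have h1 : DifferentiableAt ℝ e.map x :=
    (e.smooth.contDiffAt (e.map.open_source.mem_nhds hx)).differentiableAt (by simp)
  have h2 : DifferentiableAt ℝ e.map.symm (e.map x) :=
    (e.smooth_symm.contDiffAt (e.map.open_target.mem_nhds (e.map.map_source hx))).differentiableAt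
      (by simp)
  have h3 : fderiv ℝ (e.map.symm ∘ e.map) x = ContinuousLinearMap.id ℝ _ := by
    rw [← fderiv_id (𝕜 := ℝ) (x := x)]
    refine Filter.EventuallyEq.fderiv_eq ?_
    filter_upwards [e.map.open_source.mem_nhds hx] with y hy using e.map.left_inv hy
  rw [fderiv_comp x h2 h1] at h3
  exact Function.LeftInverse.injective (g := fderiv ℝ e.map.symm (e.map x))
    fun v => DFunLike.congr_fun h3 v

end Change

/-- The arrow defined by a coordinate transformation. -/
def LocalChange.hom {A : OrbifoldAtlas ι Z m} {x y : Obj A} (e : LocalChange x y) : x ⟶ y :=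
  Quotient.mk (germSetoid x y) e

theorem LocalChange.exists_hom_eq {A : OrbifoldAtlas ι Z m} {x y : Obj A} (g : x ⟶ y) :
    ∃ e : LocalChange x y, e.hom = g :=
  Quotient.exists_rep g

theorem LocalChange.hom_eq_iff {A : OrbifoldAtlas ι Z m} {x y : Obj A} {e e' : LocalChange x y} :
    e.hom = e'.hom ↔ e.1.map =ᶠ[𝓝 x.pt] e'.1.map :=
  Quotient.eq (r := germSetoid x y)

/-- The object `g x` of the groupoid. -/
def Obj.smul {A : OrbifoldAtlas ι Z m} (x : Obj A) (g : (A.chart x.idx).G) : Obj A :=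
  ⟨x.idx, (A.chart x.idx).act g x.pt, (A.chart x.idx).act_mem g _ x.mem⟩

/-- The arrow `x ⟶ g x`. -/
def Obj.smulHom {A : OrbifoldAtlas ι Z m} (x : Obj A) (g : (A.chart x.idx).G) : x ⟶ x.smul g :=
  LocalChange.hom ⟨Change.ofAct A x.idx g, x.mem, rfl⟩

/-- Objects over the same point of the base are related by an arrow. -/
theorem nonempty_hom_of_toBase_eq {A : OrbifoldAtlas ι Z m} {x y : Obj A}
    (h : x.toBase = y.toBase) : Nonempty (x ⟶ y) := by
  obtain ⟨c, φ, ψ, ⟨w, hw, hwz⟩, -, h1, h2⟩ := A.compatible x.idx y.idx x.toBase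
    ⟨⟨x.pt, x.mem, rfl⟩, ⟨y.pt, y.mem, h.symm⟩⟩
  have hφ := h1.mapsTo hw
  have hψ := h2.mapsTo hw
  -- The given points need not be the images of `w`: group elements carry `x` to `φ w` and `ψ w` to
  -- `y`, and the arrow sought is the germ of `ψ ∘ φ⁻¹` between two such corrections.
  obtain ⟨a, ha⟩ := ((A.chart x.idx).proj_eq_iff x.pt x.mem _ hφ).1
    (by rw [h1.proj_map w hw, hwz]; rfl)
  obtain ⟨d, hd⟩ := ((A.chart y.idx).proj_eq_iff _ hψ y.pt y.mem).1
    (by rw [h2.proj_map w hw, hwz, h]; rfl)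
  have hsrc : h1.toOpenPartialHomeomorph.symm (φ w) = w :=
    h1.toOpenPartialHomeomorph.left_inv hw
  have hx' : (⟨x.idx, φ w, hφ⟩ : Obj A) = x.smul a := by
    ext1
    · rfl
    · exact ha.symm
  have hy' : y = (⟨y.idx, ψ w, hψ⟩ : Obj A).smul d := by
    ext1
    · rfl
    · exact hd.symm
  have key : (⟨x.idx, φ w, hφ⟩ : Obj A) ⟶ (⟨y.idx, ψ w, hψ⟩ : Obj A) :=
    LocalChange.hom ⟨Change.ofEmbeddings h1 h2, by
      change φ w ∈ (OpenPartialHomeomorph.trans _ _).source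
      rw [OpenPartialHomeomorph.trans_source]
      refine ⟨h1.toOpenPartialHomeomorph.map_source hw, ?_⟩
      rw [Set.mem_preimage, hsrc]
      exact hw, congrArg ψ hsrc⟩
  have f1 := x.smulHom a
  rw [← hx'] at f1
  have f2 := (⟨y.idx, ψ w, hψ⟩ : Obj A).smulHom d
  rw [← hy'] at f2
  exact ⟨f1 ≫ key ≫ f2⟩

end Orbifold

end

noncomputable section

namespace Orbifold

/-! ### Parallel transport along arrows -/

variable {ι Z : Type*} [TopologicalSpace Z] {m : ℕ} {A : OrbifoldAtlas ι Z m}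
  {E : Type*} [TopologicalSpace E] {R : ℕ}

namespace OrbifoldVectorBundle

variable (F : OrbifoldVectorBundle A E R)

/-- Near `p`, the map `(x, v) ↦ (e(x), L v)` commutes with the projections to the total space. -/
def Transports {i j : ι} (e : Change A i j) (p : Model m) (L : Matrix (Fin R) (Fin R) ℂ) : Prop :=
  ∀ᶠ x in 𝓝 p, ∀ v, (F.chart j).proj (e.map x, L.mulVec v) = (F.chart i).proj (x, v)

theorem proj_act {i : ι} {x : Model m} (hx : x ∈ (A.chart i).dom) (k : (F.chart i).GE)
    (v : Fin R → ℂ) :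
    (F.chart i).proj ((A.chart i).act ((F.chart i).toG k) x, ((F.chart i).rep k).1.mulVec v) =
      (F.chart i).proj (x, v) :=
  (((F.chart i).proj_eq_iff x hx _ ((A.chart i).act_mem _ _ hx) _ _).2 ⟨k, rfl, rfl⟩).symm

/-- A flat bundle has constant local transition matrices along every coordinate transformation. -/
theorem IsFlat.exists_transports {F : OrbifoldVectorBundle A E R} (hF : F.IsFlat) {i j : ι}
    (e : Change A i j) {p : Model m} (hp : p ∈ e.map.source) :
    ∃ L : Matrix.GeneralLinearGroup (Fin R) ℂ, F.Transports e p L.1 := by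
  have hpi := e.source_subset hp
  have hpj := e.target_subset (e.map.map_source hp)
  obtain ⟨c, b, φ, ψ, g, h, ⟨w, hw, hwz⟩, -, -, h1, h2⟩ := hF i j ((A.chart i).proj p)
    ⟨⟨p, hpi, rfl⟩, ⟨_, hpj, e.proj_map p hp⟩⟩
  have h1' := h1.isChartEmbedding
  have h2' := h2.isChartEmbedding
  have hφ := h1'.mapsTo hw
  obtain ⟨a, ha⟩ := ((A.chart i).proj_eq_iff _ hφ p hpi).1 (by rw [h1'.proj_map w hw, hwz])
  obtain ⟨a, rfl⟩ := (F.chart i).toG_surjective a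
  -- The embedding `φ` is moved by a group element so that `w` goes exactly to `p`.
  set θ : Model m → Model m := fun x => (A.chart i).act ((F.chart i).toG a) (φ x) with hθ
  have hθe : IsChartEmbedding c (A.chart i) θ :=
    { mapsTo := fun x hx => (A.chart i).act_mem _ _ (h1'.mapsTo hx)
      injOn := fun x hx y hy hxy => h1'.injOn hx hy (by
        have := congrArg ((A.chart i).act ((F.chart i).toG a)⁻¹) hxy
        simpa only [hθ, (A.chart i).act_inv_act _ (h1'.mapsTo hx),
          (A.chart i).act_inv_act _ (h1'.mapsTo hy)] using this)
      smooth := ((A.chart i).act_smooth _).comp h1'.smooth h1'.mapsTo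
      immersion := fun x hx => by
        have hd : DifferentiableAt ℝ φ x :=
          (h1'.smooth.contDiffAt (c.isOpen_dom.mem_nhds hx)).differentiableAt (by simp)
        have := fderiv_comp x ((A.chart i).differentiableAt_act ((F.chart i).toG a)
          (h1'.mapsTo hx)) hd
        change Function.Injective (fderiv ℝ ((A.chart i).act ((F.chart i).toG a) ∘ φ) x)
        rw [this]
        exact ((Change.ofAct A i ((F.chart i).toG a)).injective_fderiv (h1'.mapsTo hx)).comp
          (h1'.immersion x hx)
      proj_map := fun x hx => by
        rw [hθ, (A.chart i).proj_act _ (h1'.mapsTo hx), h1'.proj_map x hx] }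
  have hθw : θ w = p := ha
  set W : Set (Model m) := c.dom ∩ θ ⁻¹' e.map.source with hW
  have hWo : IsOpen W := hθe.smooth.continuousOn.isOpen_inter_preimage c.isOpen_dom e.map.open_source
  have hwW : w ∈ W := ⟨hw, by rw [Set.mem_preimage, hθw]; exact hp⟩
  -- Both `e ∘ θ` and `ψ` lie over the same map to `Z`, so rigidity yields one `d` with `e ∘ θ = d
  -- ψ` near `w`.
  obtain ⟨d, hd⟩ := (A.chart j).eventually_eq_act (f := ψ) (f' := fun x => e.map (θ x)) hWo
    (h2'.smooth.mono Set.inter_subset_left)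
    (e.smooth.comp (hθe.smooth.mono Set.inter_subset_left) fun x hx => hx.2)
    (fun x hx => h2'.mapsTo hx.1) (fun x hx => e.target_subset (e.map.map_source hx.2))
    (fun x hx => h2'.immersion x hx.1)
    (fun x hx => by
      rw [h2'.proj_map x hx.1, e.proj_map _ hx.2, hθe.proj_map x hx.1]) hwW
  obtain ⟨d, rfl⟩ := (F.chart j).toG_surjective d
  -- From right to left: undo `a` and `g` to reach the common chart, then apply `h` and `d`.
  refine ⟨(F.chart j).rep d * h * g⁻¹ * ((F.chart i).rep a)⁻¹, ?_⟩
  rw [Transports, ← hθw, ← hθe.map_nhds hw, Filter.eventually_map]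
  filter_upwards [hd, c.isOpen_dom.mem_nhds hw] with x hx hxc v
  have s1 := F.proj_act (h1'.mapsTo hxc) a ((((F.chart i).rep a)⁻¹).1.mulVec v)
  have s2 := h1.proj_map x hxc ((g⁻¹ * ((F.chart i).rep a)⁻¹).1.mulVec v)
  have s3 := h2.proj_map x hxc ((g⁻¹ * ((F.chart i).rep a)⁻¹).1.mulVec v)
  have s4 := F.proj_act (h2'.mapsTo hxc) d ((h * (g⁻¹ * ((F.chart i).rep a)⁻¹)).1.mulVec v)
  rw [Matrix.mulVec_mulVec, ← Units.val_mul] at s1 s2 s3 s4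
  rw [mul_inv_cancel, Units.val_one, Matrix.one_mulVec] at s1
  rw [mul_inv_cancel_left] at s2
  rw [hx, hθ, s1, s2, ← s3, ← s4]
  simp only [mul_assoc]

/-! ### Uniqueness of parallel transport on the proper subbundle -/

variable {F}

/-- A vector of the proper subbundle is determined by its image in the total space at nearby
points. -/
theorem eq_of_eventually_proj_eq {i : ι} {p : Model m} (hp : p ∈ (A.chart i).dom)
    {u u' : Fin R → ℂ} (hu : u ∈ F.properFiber i)
    (h : ∀ᶠ x in 𝓝 p, (F.chart i).proj (x, u) = (F.chart i).proj (x, u')) : u = u' := by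
  obtain ⟨V, hV, hVo, hpV⟩ := eventually_nhds_iff.1 h
  -- Over a point with trivial isotropy the element relating `u` and `u'` lies in the kernel, which
  -- fixes `u`.
  obtain ⟨x, ⟨hxV, hx⟩, hfree⟩ := (A.chart i).exists_free hVo ⟨p, hpV, hp⟩
  obtain ⟨k, hk, hku⟩ := ((F.chart i).proj_eq_iff x hx x hx _ _).1 (hV x hxV)
  rw [← hku, hu k (hfree _ hk)]

/-- For `k` in the kernel over `j`, the vectors `L v` and `k L v` have the same image in the total
space. Hence so do `v` and `L⁻¹ k L v` at all points near `p`, and they coincide because `v` is in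
the proper fibre. -/
theorem Transports.mulVec_mem {i j : ι} {e : Change A i j} {p : Model m} (hp : p ∈ e.map.source)
    {L : Matrix.GeneralLinearGroup (Fin R) ℂ} (hL : F.Transports e p L.1) {v : Fin R → ℂ}
    (hv : v ∈ F.properFiber i) : L.1.mulVec v ∈ F.properFiber j := by
  intro k hk
  set k' := (F.chart j).rep k with hk'
  have h1 : v = (L⁻¹ * (k' * L)).1.mulVec v := by
    refine eq_of_eventually_proj_eq (e.source_subset hp) hv ?_
    filter_upwards [hL, e.map.open_source.mem_nhds hp] with x hx hxs
    have hxj := e.target_subset (e.map.map_source hxs)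
    have s := F.proj_act hxj k (L.1.mulVec v)
    rw [(MonoidHom.mem_ker).1 hk, (A.chart j).act_one _ hxj] at s
    rw [← hx v, ← s, ← hx, Matrix.mulVec_mulVec, Matrix.mulVec_mulVec, ← Units.val_mul,
      ← Units.val_mul, mul_inv_cancel_left]
  conv_rhs => rw [h1]
  rw [Matrix.mulVec_mulVec, Matrix.mulVec_mulVec, ← Units.val_mul, ← Units.val_mul,
    mul_inv_cancel_left]

/-- `L v` and `L' v` have the same image at every point near `e(p)`. This fails to determine the
matrices on all of `ℂ^R`, which is why only the proper subbundle has a holonomy. -/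
theorem Transports.mulVec_eq {i j : ι} {e : Change A i j} {p : Model m} (hp : p ∈ e.map.source)
    {L L' : Matrix.GeneralLinearGroup (Fin R) ℂ} (hL : F.Transports e p L.1)
    (hL' : F.Transports e p L'.1) {v : Fin R → ℂ} (hv : v ∈ F.properFiber i) :
    L.1.mulVec v = L'.1.mulVec v := by
  refine eq_of_eventually_proj_eq (e.target_subset (e.map.map_source hp)) (hL.mulVec_mem hp hv) ?_
  rw [← e.map.map_nhds_eq hp, Filter.eventually_map]
  filter_upwards [hL, hL'] with x hx hx'
  rw [hx, hx']

theorem Transports.congr {i j : ι} {e e' : Change A i j} {p : Model m}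
    {L : Matrix (Fin R) (Fin R) ℂ} (hL : F.Transports e p L) (h : e.map =ᶠ[𝓝 p] e'.map) :
    F.Transports e' p L := by
  filter_upwards [hL, h] with x hx hx'
  rwa [← hx']

variable (F) in
/-- `L` is a constant transition matrix of the bundle along the arrow `g`. -/
def IsTransport {x y : Obj A} (g : x ⟶ y) (L : Matrix.GeneralLinearGroup (Fin R) ℂ) : Prop :=
  ∃ e : LocalChange x y, e.hom = g ∧ F.Transports e.1 x.pt L.1

theorem IsFlat.exists_isTransport (hF : F.IsFlat) {x y : Obj A} (g : x ⟶ y) :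
    ∃ L, F.IsTransport g L := by
  obtain ⟨e, rfl⟩ := LocalChange.exists_hom_eq g
  obtain ⟨L, hL⟩ := hF.exists_transports e.1 e.2.1
  exact ⟨L, e, rfl, hL⟩

theorem IsTransport.mulVec_mem {x y : Obj A} {g : x ⟶ y}
    {L : Matrix.GeneralLinearGroup (Fin R) ℂ} (hL : F.IsTransport g L) {v : Fin R → ℂ}
    (hv : v ∈ F.properFiber x.idx) : L.1.mulVec v ∈ F.properFiber y.idx := by
  obtain ⟨e, -, h⟩ := hL
  exact h.mulVec_mem e.2.1 hv

theorem IsTransport.mulVec_eq {x y : Obj A} {g : x ⟶ y}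
    {L L' : Matrix.GeneralLinearGroup (Fin R) ℂ} (hL : F.IsTransport g L)
    (hL' : F.IsTransport g L') {v : Fin R → ℂ} (hv : v ∈ F.properFiber x.idx) :
    L.1.mulVec v = L'.1.mulVec v := by
  obtain ⟨e, rfl, h⟩ := hL
  obtain ⟨e', he, h'⟩ := hL'
  exact h.mulVec_eq e.2.1 (h'.congr (LocalChange.hom_eq_iff.1 he)) hv

theorem IsTransport.point_eq {x y : Obj A} {g : x ⟶ y}
    {L : Matrix.GeneralLinearGroup (Fin R) ℂ} (hL : F.IsTransport g L) (v : Fin R → ℂ) :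
    F.point y (L.1.mulVec v) = F.point x v := by
  obtain ⟨e, -, h⟩ := hL
  have := h.self_of_nhds v
  rwa [e.2.2] at this

theorem isTransport_id (x : Obj A) : F.IsTransport (𝟙 x) 1 := by
  refine ⟨⟨Change.id A x.idx, x.mem, rfl⟩, rfl, Filter.Eventually.of_forall fun y v => ?_⟩
  rw [Units.val_one, Matrix.one_mulVec]
  rfl

theorem IsTransport.comp {x y z : Obj A} {g : x ⟶ y} {h : y ⟶ z}
    {L L' : Matrix.GeneralLinearGroup (Fin R) ℂ} (hL : F.IsTransport g L)
    (hL' : F.IsTransport h L') : F.IsTransport (g ≫ h) (L' * L) := by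
  obtain ⟨e, rfl, h⟩ := hL
  obtain ⟨f, rfl, h'⟩ := hL'
  refine ⟨⟨e.1.trans f.1, ?_, ?_⟩, rfl, ?_⟩
  · change _ ∈ (e.1.map.trans f.1.map).source
    rw [OpenPartialHomeomorph.trans_source]
    exact ⟨e.2.1, by rw [Set.mem_preimage, e.2.2]; exact f.2.1⟩
  · change f.1.map (e.1.map x.pt) = z.pt
    rw [e.2.2, f.2.2]
  · have ht := e.1.map.map_nhds_eq e.2.1
    rw [e.2.2] at ht
    rw [Transports, ← ht, Filter.eventually_map] at h'
    filter_upwards [h, h'] with q hq hq' v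
    rw [Units.val_mul, ← Matrix.mulVec_mulVec, ← hq v, ← hq']
    rfl

theorem isTransport_smulHom (x : Obj A) (k : (F.chart x.idx).GE) :
    F.IsTransport (x.smulHom ((F.chart x.idx).toG k)) ((F.chart x.idx).rep k) := by
  refine ⟨_, rfl, ?_⟩
  filter_upwards [(A.chart x.idx).isOpen_dom.mem_nhds x.mem] with y hy v
  exact F.proj_act hy k v

/-- A linear projection onto the fibre of the proper subbundle. -/
theorem exists_properProj (F : OrbifoldVectorBundle A E R) (i : ι) :
    ∃ P : Module.End ℂ (Fin R → ℂ), (∀ v, P v ∈ F.properFiber i) ∧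
      ∀ v ∈ F.properFiber i, P v = v := by
  obtain ⟨Q, hQ⟩ := LinearMap.exists_leftInverse_of_injective (F.properFiber i).subtype
    (Submodule.ker_subtype _)
  exact ⟨(F.properFiber i).subtype ∘ₗ Q, fun v => (Q v).2,
    fun v hv => congrArg (F.properFiber i).subtype
      (show Q ((F.properFiber i).subtype ⟨v, hv⟩) = ⟨v, hv⟩ from DFunLike.congr_fun hQ _)⟩

variable (F) in
/-- A chosen linear projection onto the fibre of the proper subbundle. -/
def properProj (i : ι) : Module.End ℂ (Fin R → ℂ) := (exists_properProj F i).choose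

theorem properProj_mem (i : ι) (v : Fin R → ℂ) : F.properProj i v ∈ F.properFiber i :=
  (exists_properProj F i).choose_spec.1 v

theorem properProj_apply {i : ι} {v : Fin R → ℂ} (hv : v ∈ F.properFiber i) :
    F.properProj i v = v :=
  (exists_properProj F i).choose_spec.2 v hv

/-- Parallel transport of the proper subbundle along an arrow, extended by the chosen projections to
an endomorphism of `ℂ^R`. -/
def IsFlat.transport (hF : F.IsFlat) {x y : Obj A} (g : x ⟶ y) : Module.End ℂ (Fin R → ℂ) :=
  (Matrix.mulVecLin (hF.exists_isTransport g).choose.1) * F.properProj x.idx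

variable (hF : F.IsFlat)

namespace IsFlat

/-- The matrix chosen in the definition is immaterial: after the projection only proper vectors are
seen, and on these all transition matrices agree. -/
theorem transport_eq {x y : Obj A} {g : x ⟶ y} {L : Matrix.GeneralLinearGroup (Fin R) ℂ}
    (hL : F.IsTransport g L) : hF.transport g = Matrix.mulVecLin L.1 * F.properProj x.idx :=
  LinearMap.ext fun v =>
    (hF.exists_isTransport g).choose_spec.mulVec_eq hL (properProj_mem x.idx v)

theorem transport_apply {x y : Obj A} {g : x ⟶ y} {L : Matrix.GeneralLinearGroup (Fin R) ℂ}
    (hL : F.IsTransport g L) {v : Fin R → ℂ} (hv : v ∈ F.properFiber x.idx) :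
    hF.transport g v = L.1.mulVec v := by
  rw [hF.transport_eq hL, Module.End.mul_apply, properProj_apply hv, Matrix.mulVecLin_apply]

theorem transport_mem {x y : Obj A} (g : x ⟶ y) (v : Fin R → ℂ) :
    hF.transport g v ∈ F.properFiber y.idx :=
  (hF.exists_isTransport g).choose_spec.mulVec_mem (properProj_mem _ v)

theorem point_transport {x y : Obj A} (g : x ⟶ y) {v : Fin R → ℂ}
    (hv : v ∈ F.properFiber x.idx) : F.point y (hF.transport g v) = F.point x v := by
  obtain ⟨L, hL⟩ := hF.exists_isTransport g
  rw [hF.transport_apply hL hv, hL.point_eq]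

theorem transport_mul_properProj {x y : Obj A} (g : x ⟶ y) :
    hF.transport g * F.properProj x.idx = hF.transport g := by
  refine LinearMap.ext fun v => ?_
  rw [Module.End.mul_apply, transport, Module.End.mul_apply, Module.End.mul_apply,
    properProj_apply (properProj_mem _ v)]

/-- Identity arrows act as the chosen projection, not as the identity of `ℂ^R`. Later computations
absorb these projections into neighbouring factors. -/
theorem transport_id (x : Obj A) : hF.transport (𝟙 x) = F.properProj x.idx := by
  rw [hF.transport_eq (isTransport_id x), Units.val_one, Matrix.mulVecLin_one]
  rfl

theorem transport_comp {x y z : Obj A} (g : x ⟶ y) (h : y ⟶ z) :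
    hF.transport (g ≫ h) = hF.transport h * hF.transport g := by
  obtain ⟨L, hL⟩ := hF.exists_isTransport g
  obtain ⟨L', hL'⟩ := hF.exists_isTransport h
  refine LinearMap.ext fun v => ?_
  rw [Module.End.mul_apply, hF.transport_apply hL' (hF.transport_mem g v),
    hF.transport_eq (hL.comp hL'), hF.transport_eq hL, Units.val_mul, Matrix.mulVecLin_mul]
  rfl

/-- Parallel transport is locally constant on the space of arrows. -/
theorem isLocallyConstant_transport :
    IsLocallyConstant fun a : Arrow A => hF.transport a.hom := by
  rw [IsLocallyConstant.iff_exists_open]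
  rintro ⟨x, ⟨j, y, hy⟩, g⟩
  obtain ⟨⟨e, hxe, hexy⟩, rfl⟩ := LocalChange.exists_hom_eq g
  dsimp only at e hexy
  subst hexy
  obtain ⟨L, hL⟩ := hF.exists_transports e hxe
  -- The same `L` is a transition matrix at every point of `O`, so the germs of `e` restricted to
  -- `O` form a basic open set of arrows with constant transport.
  obtain ⟨O, hO, hOo, hxO⟩ := eventually_nhds_iff.1 (eventually_eventually_nhds.2 hL)
  let e' : Change A x.idx j :=
    { map := e.map.restrOpen O hOo
      source_subset := fun y hy => e.source_subset hy.1
      target_subset := by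
        rintro y hy
        rw [← (e.map.restrOpen O hOo).right_inv hy]
        exact e.target_subset (e.map.map_source ((e.map.restrOpen O hOo).map_target hy).1)
      smooth := e.smooth.mono fun y hy => hy.1
      smooth_symm := e.smooth_symm.mono fun y hy => by
        rw [← (e.map.restrOpen O hOo).right_inv hy]
        exact e.map.map_source ((e.map.restrOpen O hOo).map_target hy).1
      proj_map := fun y hy => e.proj_map y hy.1 }
  have hT : ∀ y (hy : y ∈ e'.map.source), hF.transport (e'.germAt y hy).hom =
      Matrix.mulVecLin L.1 * F.properProj x.idx := fun y hy =>
    hF.transport_eq (x := ⟨x.idx, y, e'.source_subset hy⟩) ⟨⟨e', hy, rfl⟩, rfl, hO y hy.2⟩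
  refine ⟨{a | ∃ y hy, a = e'.germAt y hy}, TopologicalSpace.isOpen_generateFrom_of_mem
    ⟨_, _, e', rfl⟩, ⟨x.pt, ⟨hxe, hxO⟩,
      congrArg (Arrow.mk x ⟨j, e.map x.pt, hy⟩) (LocalChange.hom_eq_iff.2 Filter.EventuallyEq.rfl)⟩, ?_⟩
  rintro _ ⟨y, hy, rfl⟩
  rw [hT y hy]
  exact (hF.transport_eq ⟨_, rfl, hL⟩).symm

end IsFlat

end OrbifoldVectorBundle

end Orbifold

end

noncomputable section

namespace Orbifold

/-! ### Holonomy of `𝒢`-paths -/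

variable {ι Z : Type*} [TopologicalSpace Z] {m : ℕ} {A : OrbifoldAtlas ι Z m}
  {E : Type*} [TopologicalSpace E] {R : ℕ}

theorem isLocallyConstant_idx (A : OrbifoldAtlas ι Z m) :
    IsLocallyConstant (Obj.idx : Obj A → ι) := by
  intro s
  refine ⟨Sigma.fst ⁻¹' s, isOpen_sigma_fst_preimage s, rfl⟩

/-- A path in the space of objects stays in one chart. -/
theorem idx_path {y z : Obj A} (b : Path y z) (u : I) : (b u).idx = y.idx := by
  have h := ((isLocallyConstant_idx A).comp_continuous b.continuous).apply_eq_of_preconnectedSpace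
    u 0
  simpa using h

theorem idx_eq_of_path {y z : Obj A} (b : Path y z) : z.idx = y.idx := by
  simpa using idx_path b 1

namespace OrbifoldVectorBundle

variable {F : OrbifoldVectorBundle A E R} (hF : F.IsFlat)

theorem properProj_mul_eq {i : ι} {M : Module.End ℂ (Fin R → ℂ)}
    (h : ∀ v, M v ∈ F.properFiber i) : F.properProj i * M = M :=
  LinearMap.ext fun v => properProj_apply (h v)

namespace IsFlat

theorem properProj_mul_transport {x y : Obj A} (g : x ⟶ y) :
    F.properProj y.idx * hF.transport g = hF.transport g :=
  properProj_mul_eq (hF.transport_mem g)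

/-- The holonomy of a `𝒢`-path: the product of the parallel transports along its arrows. -/
def holonomy {x w : Obj A} (c : GPath x w) : Module.End ℂ (Fin R → ℂ) :=
  -- Endomorphisms act on the left, so the last arrow gives the leftmost factor.
  (c.arrows.map fun a => hF.transport a.hom).reverse.prod

theorem holonomy_single {x y z w : Obj A} (g : x ⟶ y) (b : Path y z) (g' : z ⟶ w) :
    hF.holonomy (.single g b g') = hF.transport g' * hF.transport g := by
  simp [holonomy, GPath.arrows]

theorem holonomy_cons {x y z w : Obj A} (g : x ⟶ y) (b : Path y z) (c : GPath z w) :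
    hF.holonomy (.cons g b c) = hF.holonomy c * hF.transport g := by
  simp [holonomy, GPath.arrows]

theorem holonomy_precomp {x x' w : Obj A} (h : x' ⟶ x) (c : GPath x w) :
    hF.holonomy (c.precomp h) = hF.holonomy c * hF.transport h := by
  cases c <;> simp [GPath.precomp, holonomy_single, holonomy_cons, transport_comp, mul_assoc]

theorem holonomy_comp {x y w : Obj A} (c : GPath x y) (d : GPath y w) :
    hF.holonomy (c.comp d) = hF.holonomy d * hF.holonomy c := by
  induction c with
  | single g b g' =>
    simp [GPath.comp, holonomy_single, holonomy_cons, holonomy_precomp, mul_assoc]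
  | cons g b c ih => simp [GPath.comp, holonomy_cons, ih, mul_assoc]

theorem holonomy_mul_properProj {x w : Obj A} (c : GPath x w) :
    hF.holonomy c * F.properProj x.idx = hF.holonomy c := by
  cases c <;> simp [holonomy_single, holonomy_cons, mul_assoc, transport_mul_properProj]

theorem properProj_mul_holonomy {x w : Obj A} (c : GPath x w) :
    F.properProj w.idx * hF.holonomy c = hF.holonomy c := by
  induction c with
  | single g b g' => rw [holonomy_single, ← mul_assoc, properProj_mul_transport]
  | cons g b c ih => rw [holonomy_cons, ← mul_assoc, ih]

/-- The family `H` is a path in the space of arrows, where transport is locally constant. -/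
theorem transport_eq_of_arrowAlong {y z y' z' : Obj A} {b : Path y z} {b' : Path y' z'}
    {h₀ : y ⟶ y'} {h₁ : z ⟶ z'} (H : GPath.ArrowAlong b b' h₀ h₁) :
    hF.transport h₀ = hF.transport h₁ := by
  obtain ⟨H, -, h0, h1⟩ := H
  have := (hF.isLocallyConstant_transport.comp_continuous
    H.continuous).apply_eq_of_preconnectedSpace 0 1
  simp only [Function.comp_apply] at this
  rwa [h0, h1] at this

/-- Each arrow varies along a path in the space of arrows, so its transport is constant; the
deformation of the `b_i` is irrelevant. -/
theorem holonomy_eq_of_elementaryHomotopy {x w : Obj A} {c c' : GPath x w}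
    (H : GPath.ElementaryHomotopy c c') : hF.holonomy c = hF.holonomy c' := by
  obtain ⟨C, -, g, rfl, rfl, -, hg, -, -⟩ := H
  have key : ∀ γ : C(I, Arrow A), hF.transport (γ 0).hom = hF.transport (γ 1).hom := fun γ =>
    (hF.isLocallyConstant_transport.comp_continuous
      γ.continuous).apply_eq_of_preconnectedSpace 0 1
  simp only [holonomy, hg, List.map_map, Function.comp_def, key]

/-- Subdivision inserts an identity arrow, whose projection is absorbed since a path stays in one
chart. A change of chart inserts `h₀` and `h₁⁻¹`, and these cancel because `h₀` and `h₁` have the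
same transport. -/
theorem holonomy_eq_of_step {x w : Obj A} {c c' : GPath x w} (H : GPath.Step c c') :
    hF.holonomy c = hF.holonomy c' := by
  induction H with
  | subdivide_last g p q g' =>
    rw [holonomy_cons, holonomy_single, holonomy_single, transport_id, ← idx_eq_of_path q,
      transport_mul_properProj]
  | subdivide g p q c =>
    rw [holonomy_cons, holonomy_cons, holonomy_cons, transport_id, ← idx_eq_of_path q,
      holonomy_mul_properProj]
  | change_last g b g' b' h₀ h₁ H =>
    rw [holonomy_single, holonomy_single, transport_comp, transport_comp,
      hF.transport_eq_of_arrowAlong H]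
    rw [mul_assoc, ← mul_assoc _ (hF.transport h₁), ← transport_comp, Groupoid.comp_inv,
      transport_id, ← mul_assoc, transport_mul_properProj]
  | change g b c b' h₀ h₁ H =>
    rw [holonomy_cons, holonomy_cons, transport_comp, holonomy_precomp,
      hF.transport_eq_of_arrowAlong H]
    rw [mul_assoc, ← mul_assoc _ (hF.transport h₁), ← transport_comp, Groupoid.comp_inv,
      transport_id, ← mul_assoc, holonomy_mul_properProj]
  | tail g b H ih => rw [holonomy_cons, holonomy_cons, ih]
  | homotopy H => exact hF.holonomy_eq_of_elementaryHomotopy H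

/-- The holonomy of a homotopy class of `𝒢`-paths. -/
def hol {x w : Obj A} : PathClass x w → Module.End ℂ (Fin R → ℂ) :=
  Quot.lift hF.holonomy fun _ _ h => hF.holonomy_eq_of_step h

theorem hol_mk {x w : Obj A} (c : GPath x w) : hF.hol (PathClass.mk c) = hF.holonomy c := rfl

theorem hol_comp {x y w : Obj A} (a : PathClass x y) (b : PathClass y w) :
    hF.hol (a.comp b) = hF.hol b * hF.hol a := by
  induction a using Quot.ind
  induction b using Quot.ind
  exact hF.holonomy_comp _ _

theorem hol_mul_properProj {x w : Obj A} (a : PathClass x w) :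
    hF.hol a * F.properProj x.idx = hF.hol a := by
  induction a using Quot.ind
  exact hF.holonomy_mul_properProj _

theorem properProj_mul_hol {x w : Obj A} (a : PathClass x w) :
    F.properProj w.idx * hF.hol a = hF.hol a := by
  induction a using Quot.ind
  exact hF.properProj_mul_holonomy _

theorem hol_mem {x w : Obj A} (a : PathClass x w) (v : Fin R → ℂ) :
    hF.hol a v ∈ F.properFiber w.idx := by
  rw [← properProj_mul_hol]
  exact properProj_mem _ _

theorem hol_ofArrow {x y : Obj A} (g : x ⟶ y) :
    hF.hol (PathClass.mk (.ofArrow g)) = hF.transport g := by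
  rw [hol_mk, GPath.ofArrow, holonomy_single, transport_id, transport_mul_properProj]

theorem hol_refl (x : Obj A) : hF.hol (PathClass.refl x) = F.properProj x.idx := by
  rw [PathClass.refl, hol_ofArrow, transport_id]

/-- Flat coordinates are constant inside a chart. This makes `T` in the theorem independent of the
path `b`, and reduces smoothness on `X` to smoothness of lifts. -/
theorem hol_comp_path {x y w : Obj A} (a : PathClass x y) (b : Path y w) :
    hF.hol (a.comp (PathClass.mk (.single (𝟙 y) b (𝟙 w)))) = hF.hol a := by
  rw [hol_comp, hol_mk, holonomy_single, transport_id, transport_id, idx_eq_of_path b, mul_assoc,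
    properProj_mul_hol, properProj_mul_hol]

/-- Homotopy classes of `𝒢`-paths are invertible, and so is their holonomy on the proper
subbundle. -/
theorem exists_inverse {x w : Obj A} (a : PathClass x w) :
    ∃ d : PathClass w x, d.comp a = PathClass.refl w ∧
      hF.hol a * hF.hol d = F.properProj w.idx ∧ hF.hol d * hF.hol a = F.properProj x.idx := by
  induction a using Quot.ind with | mk c => ?_
  have h1 : hF.hol (PathClass.mk c) * hF.hol (PathClass.mk c.inv) = F.properProj w.idx := by
    rw [← hol_comp, PathClass.inv_comp, hol_refl]
  have h2 : hF.hol (PathClass.mk c.inv) * hF.hol (PathClass.mk c.inv.inv) =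
      F.properProj x.idx := by
    rw [← hol_comp, PathClass.inv_comp, hol_refl]
  refine ⟨PathClass.mk c.inv, PathClass.inv_comp c, h1, ?_⟩
  -- `PathClass.inv_comp` inverts on one side only. Used for `c` and for `c.inv`, it shows that `c`
  -- and `c.inv.inv` have the same holonomy, as two inverses of that of `c.inv`.
  have h3 : hF.hol (PathClass.mk c) = hF.hol (PathClass.mk c.inv.inv) := by
    rw [← hol_mul_properProj, ← h2, ← mul_assoc, h1, properProj_mul_hol]
  change hF.hol _ * hF.hol (PathClass.mk c) = _
  rw [h3, h2]

/-- Together with `exists_hol_eq`, this makes holonomy an isomorphism between the proper fibres at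
the two ends, so the rank is the same in all charts joined by `𝒢`-paths. -/
theorem hol_injOn {x w : Obj A} (a : PathClass x w) {u v : Fin R → ℂ}
    (hu : u ∈ F.properFiber x.idx) (hv : v ∈ F.properFiber x.idx) (h : hF.hol a u = hF.hol a v) :
    u = v := by
  obtain ⟨d, -, -, hd⟩ := hF.exists_inverse a
  rw [← properProj_apply hu, ← properProj_apply hv, ← hd, Module.End.mul_apply, h]
  rfl

theorem exists_hol_eq {x w : Obj A} (a : PathClass x w) {u : Fin R → ℂ}
    (hu : u ∈ F.properFiber w.idx) : ∃ v ∈ F.properFiber x.idx, hF.hol a v = u := by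
  obtain ⟨d, -, hd, -⟩ := hF.exists_inverse a
  refine ⟨hF.hol d u, hF.hol_mem d u, ?_⟩
  rw [← Module.End.mul_apply, hd, properProj_apply hu]

/-! ### The holonomy representation -/

/-- The holonomy of an element of the orbifold fundamental group. -/
def loopHol {x₀ : Obj A} (γ : FundamentalGroup A x₀) : Module.End ℂ (Fin R → ℂ) :=
  hF.hol (show PathClass x₀ x₀ from γ)

theorem loopHol_mul {x₀ : Obj A} (γ γ' : FundamentalGroup A x₀) :
    hF.loopHol (γ * γ') = hF.loopHol γ' * hF.loopHol γ :=
  hF.hol_comp _ _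

theorem loopHol_one (x₀ : Obj A) :
    hF.loopHol (1 : FundamentalGroup A x₀) = F.properProj x₀.idx :=
  hF.hol_refl x₀

theorem loopHol_mem {x₀ : Obj A} (γ : FundamentalGroup A x₀) (v : Fin R → ℂ) :
    hF.loopHol γ v ∈ F.properFiber x₀.idx :=
  hF.hol_mem _ v

/-- The holonomy representation of the orbifold fundamental group on the fibre of the proper
subbundle at the base point. -/
def holonomyRep (x₀ : Obj A) :
    FundamentalGroup A x₀ →* Module.End ℂ (F.properFiber x₀.idx) where
  -- Holonomy reverses products; the inverse loop restores a homomorphism.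
  toFun γ := (hF.loopHol γ⁻¹).restrict fun v _ => hF.loopHol_mem γ⁻¹ v
  map_one' := by
    refine LinearMap.ext fun v => Subtype.ext ?_
    rw [LinearMap.coe_restrict_apply, inv_one, loopHol_one, properProj_apply v.2]
    rfl
  map_mul' γ γ' := by
    refine LinearMap.ext fun v => Subtype.ext ?_
    rw [LinearMap.coe_restrict_apply, mul_inv_rev, loopHol_mul]
    rfl

theorem loopHol_holonomyRep {x₀ : Obj A} (γ : FundamentalGroup A x₀)
    (v : F.properFiber x₀.idx) : hF.loopHol γ (hF.holonomyRep x₀ γ v) = v := by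
  change (hF.loopHol γ * hF.loopHol γ⁻¹) v.1 = v
  rw [← loopHol_mul, inv_mul_cancel, loopHol_one, properProj_apply v.2]

/-- The holonomy representation in a basis of the fibre of the proper subbundle. -/
theorem exists_rep (x₀ : Obj A) :
    ∃ (r : ℕ) (J : (Fin r → ℂ) →ₗ[ℂ] (Fin R → ℂ))
      (ρ : FundamentalGroup A x₀ →* Matrix.GeneralLinearGroup (Fin r) ℂ),
      Function.Injective J ∧ LinearMap.range J = F.properFiber x₀.idx ∧
      ∀ (γ : FundamentalGroup A x₀) v, hF.loopHol γ (J ((ρ γ).1.mulVec v)) = J v := by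
  let V := F.properFiber x₀.idx
  let b := Module.finBasis ℂ V
  let ρ : FundamentalGroup A x₀ →* Matrix.GeneralLinearGroup (Fin (Module.finrank ℂ V)) ℂ :=
    -- A homomorphism from a group to a monoid of matrices lands in the invertible ones.
    MonoidHom.toHomUnits (((LinearMap.toMatrixAlgEquiv b : Module.End ℂ V ≃ₐ[ℂ] _) :
      Module.End ℂ V →* _).comp (hF.holonomyRep x₀))
  refine ⟨Module.finrank ℂ V, V.subtype ∘ₗ b.equivFun.symm.toLinearMap, ρ, ?_, ?_, fun γ v => ?_⟩
  · exact Subtype.val_injective.comp b.equivFun.symm.injective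
  · rw [LinearMap.range_comp_of_range_eq_top _ (LinearEquiv.range _), Submodule.range_subtype]
  · have h : b.equivFun.symm ((ρ γ).1.mulVec v) =
        hF.holonomyRep x₀ γ (b.equivFun.symm v) := by
      rw [LinearEquiv.symm_apply_eq]
      have := LinearMap.toMatrix_mulVec_repr b b (hF.holonomyRep x₀ γ) (b.equivFun.symm v)
      rw [← b.equivFun_apply, LinearEquiv.apply_symm_apply] at this
      exact this
    change hF.loopHol γ ((b.equivFun.symm ((ρ γ).1.mulVec v)).1) = (b.equivFun.symm v).1
    rw [h, loopHol_holonomyRep]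

end IsFlat

end OrbifoldVectorBundle

/-! ### Connectedness -/

theorem exists_path_of_joinedIn {i : ι} {p q : Model m} {N : Set (Model m)}
    (hN : N ⊆ (A.chart i).dom) (h : JoinedIn N p q) :
    ∃ b : Path (⟨i, p, hN h.source_mem⟩ : Obj A) ⟨i, q, hN h.target_mem⟩, ∀ u, (b u).pt ∈ N := by
  refine ⟨{ toFun := fun u => ⟨i, h.somePath u, hN (h.somePath_mem u)⟩
            continuous_toFun := ?_
            source' := by simp
            target' := by simp }, fun u => h.somePath_mem u⟩
  refine continuous_induced_rng.2 ?_
  change Continuous fun u =>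
    (Sigma.mk i ⟨h.somePath u, hN (h.somePath_mem u)⟩ : Σ i : ι, (A.chart i).dom)
  exact continuous_sigmaMk.comp (Continuous.subtype_mk h.somePath.continuous _)

theorem exists_path_of_idx_eq {x y : Obj A} (h : x.idx = y.idx) : Nonempty (Path x y) := by
  obtain ⟨i, p, hp⟩ := x
  obtain ⟨j, q, hq⟩ := y
  dsimp only at h
  subst h
  have hc := (A.chart i).isOpen_dom.isConnected_iff_isPathConnected.1 (A.chart i).isConnected_dom
  obtain ⟨b, -⟩ := exists_path_of_joinedIn (A := A) subset_rfl (hc.joinedIn p hp q hq)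
  exact ⟨b⟩

/-- If `Z` is connected then any two objects are joined by a `𝒢`-path. -/
theorem nonempty_gpath [ConnectedSpace Z] (x₀ x : Obj A) : Nonempty (GPath x₀ x) := by
  set S : Set ι := {i | ∃ y : Obj A, y.idx = i ∧ Nonempty (GPath x₀ y)} with hS
  have reach : ∀ {y : Obj A}, y.idx ∈ S → Nonempty (GPath x₀ y) := by
    rintro y ⟨y', hy', ⟨c⟩⟩
    obtain ⟨b⟩ := exists_path_of_idx_eq hy'
    exact ⟨c.comp (.single (𝟙 _) b (𝟙 _))⟩
  have hopen : ∀ T : Set ι, IsOpen (⋃ i ∈ T, (A.chart i).image) := fun T =>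
    isOpen_biUnion fun i _ => (A.chart i).proj_isOpen _ subset_rfl (A.chart i).isOpen_dom
  have mem : ∀ {T : Set ι} (y : Obj A), y.idx ∈ T → y.toBase ∈ ⋃ i ∈ T, (A.chart i).image :=
    fun y hy => Set.mem_biUnion hy ⟨y.pt, y.mem, rfl⟩
  have x₀S : x₀.idx ∈ S := ⟨x₀, rfl, ⟨.single (𝟙 _) (Path.refl _) (𝟙 _)⟩⟩
  refine reach ?_
  by_contra hx
  -- The images of the reachable charts and of the unreachable ones form two nonempty open sets
  -- covering `Z`, so they meet. An arrow over a common point then reaches an unreachable chart.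
  obtain ⟨z, -, hz, hz'⟩ := (isPreconnected_univ (α := Z)) _ _ (hopen S) (hopen Sᶜ)
    (fun z _ => by
      obtain ⟨i, p, hp, rfl⟩ := A.cover z
      by_cases hi : i ∈ S
      · exact .inl (mem ⟨i, p, hp⟩ hi)
      · exact .inr (mem ⟨i, p, hp⟩ hi))
    ⟨_, trivial, mem x₀ x₀S⟩ ⟨_, trivial, mem x hx⟩
  obtain ⟨i, hi, p, hp, hpz⟩ := Set.mem_iUnion₂.1 hz
  obtain ⟨j, hj, q, hq, hqz⟩ := Set.mem_iUnion₂.1 hz'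
  obtain ⟨g⟩ := nonempty_hom_of_toBase_eq (x := (⟨i, p, hp⟩ : Obj A)) (y := ⟨j, q, hq⟩)
    (hpz.trans hqz.symm)
  obtain ⟨c⟩ := reach (y := ⟨i, p, hp⟩) hi
  exact hj ⟨⟨j, q, hq⟩, rfl, ⟨c.comp (.ofArrow g)⟩⟩

end Orbifold

end

noncomputable section

namespace Orbifold

/-! ### Sections and equivariant functions -/

variable {ι Z : Type*} [TopologicalSpace Z] {m : ℕ} {A : OrbifoldAtlas ι Z m}
  {E : Type*} [TopologicalSpace E] {R : ℕ}

/-- The value of a family of lifts at an object of the groupoid. -/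
def Obj.eval (x : Obj A) (ξ : ∀ i, (A.chart i).dom → Fin R → ℂ) : Fin R → ℂ :=
  ξ x.idx ⟨x.pt, x.mem⟩

namespace OrbifoldVectorBundle

variable {F : OrbifoldVectorBundle A E R} (hF : F.IsFlat)

theorem IsLift.point_eval {s : Z → E} {ξ : ∀ i, (A.chart i).dom → Fin R → ℂ}
    (h : F.IsLift s ξ) (x : Obj A) : F.point x (x.eval ξ) = s x.toBase :=
  (h.proj_lift x.idx ⟨x.pt, x.mem⟩).symm

/-- The kernel acts trivially on the chart, so invariance says that it fixes the values of a lift.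
Sections of `F` are thus sections of the proper subbundle. -/
theorem IsLift.eval_mem {s : Z → E} {ξ : ∀ i, (A.chart i).dom → Fin R → ℂ}
    (h : F.IsLift s ξ) (x : Obj A) : x.eval ξ ∈ F.properFiber x.idx := by
  intro k hk
  rw [Obj.eval, ← h.invariant]
  congr 1
  refine Subtype.ext ?_
  change (A.chart x.idx).act ((F.chart x.idx).toG k) x.pt = x.pt
  rw [MonoidHom.mem_ker.1 hk, (A.chart x.idx).act_one _ x.mem]

/-- Both vectors lie over `y` and represent the same value of `s`; the value of an invariant lift is
determined by its image in the total space. -/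
theorem IsLift.eval_transport {s : Z → E} {ξ : ∀ i, (A.chart i).dom → Fin R → ℂ}
    (h : F.IsLift s ξ) {x y : Obj A} (g : x ⟶ y) :
    hF.transport g (x.eval ξ) = y.eval ξ := by
  refine (F.eq_of_proj_eq h ⟨y.pt, y.mem⟩ ?_).symm
  have h1 := hF.point_transport g (h.eval_mem x)
  rw [h.point_eval, toBase_eq_of_hom g, ← h.point_eval y] at h1
  exact h1.symm

namespace IsFlat

variable {x₀ : Obj A} {r : ℕ} (J : (Fin r → ℂ) →ₗ[ℂ] (Fin R → ℂ))

/-- The map `X × ℂ^r → 𝓕` defined by holonomy. -/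
def coverMap :
    UniversalCover A x₀ → (Fin r → ℂ) → E :=
  Quot.lift (fun q v => F.point q.endpt (hF.hol q.cls (J v))) (by
    rintro q _ ⟨w, g, rfl⟩
    funext v
    change _ = F.point w (hF.hol (q.cls.comp (PathClass.mk (.ofArrow g))) (J v))
    rw [hol_comp, hol_ofArrow, Module.End.mul_apply, hF.point_transport g (hF.hol_mem _ _)])

/-- The function `f` on the universal cover is the family `ξ` of lifts, transported to the fibre at
the base point. -/
def Corresponds (ξ : ∀ i, (A.chart i).dom → Fin R → ℂ) (f : UniversalCover A x₀ → Fin r → ℂ) :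
    Prop :=
  ∀ q : BasedPaths A x₀, hF.hol q.cls (J (f (UniversalCover.mk q))) = q.endpt.eval ξ

variable {J} {hF}

theorem mem_of_range (hJ : LinearMap.range J = F.properFiber x₀.idx) (v : Fin r → ℂ) :
    J v ∈ F.properFiber x₀.idx := hJ ▸ LinearMap.mem_range_self J v

theorem Corresponds.right_unique (hJi : Function.Injective J)
    (hJ : LinearMap.range J = F.properFiber x₀.idx) {ξ : ∀ i, (A.chart i).dom → Fin R → ℂ}
    {f f' : UniversalCover A x₀ → Fin r → ℂ} (h : hF.Corresponds J ξ f)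
    (h' : hF.Corresponds J ξ f') : f = f' := by
  funext x
  induction x using Quot.ind with | mk q => ?_
  exact hJi (hF.hol_injOn q.cls (mem_of_range hJ _) (mem_of_range hJ _)
    ((h q).trans (h' q).symm))

/-- Connectedness enters here: every object is the end point of a path from `x₀`, so `f` sees all
values of the lifts. -/
theorem Corresponds.left_unique [ConnectedSpace Z]
    {ξ ξ' : ∀ i, (A.chart i).dom → Fin R → ℂ} {f : UniversalCover A x₀ → Fin r → ℂ}
    (h : hF.Corresponds J ξ f) (h' : hF.Corresponds J ξ' f) : ξ = ξ' := by
  funext i x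
  obtain ⟨c⟩ := nonempty_gpath x₀ (⟨i, x.1, x.2⟩ : Obj A)
  exact (h ⟨_, PathClass.mk c⟩).symm.trans (h' ⟨_, PathClass.mk c⟩)

theorem Corresponds.add {ξ ξ' : ∀ i, (A.chart i).dom → Fin R → ℂ}
    {f f' : UniversalCover A x₀ → Fin r → ℂ} (h : hF.Corresponds J ξ f)
    (h' : hF.Corresponds J ξ' f') : hF.Corresponds J (ξ + ξ') (f + f') := fun q => by
  rw [Pi.add_apply, map_add, map_add, h q, h' q]
  rfl

theorem Corresponds.smul {ξ : ∀ i, (A.chart i).dom → Fin R → ℂ}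
    {f : UniversalCover A x₀ → Fin r → ℂ} (a : ℂ) (h : hF.Corresponds J ξ f) :
    hF.Corresponds J (a • ξ) (a • f) := fun q => by
  rw [Pi.smul_apply, map_smul, map_smul, h q]
  rfl

variable {ρ : FundamentalGroup A x₀ →* Matrix.GeneralLinearGroup (Fin r) ℂ}

/-- In the composite the loop `γ` is run first, so its holonomy acts first and cancels `ρ γ`.
Invariance of `Φ` and equivariance of `f` both come from this. -/
theorem hol_rep (hρ : ∀ (γ : FundamentalGroup A x₀) v, hF.loopHol γ (J ((ρ γ).1.mulVec v)) = J v)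
    (γ : FundamentalGroup A x₀) {w : Obj A} (a : PathClass x₀ w) (v : Fin r → ℂ) :
    hF.hol (PathClass.comp γ a) (J ((ρ γ).1.mulVec v)) = hF.hol a (J v) := by
  have h : hF.hol (PathClass.comp γ a) = hF.hol a * hF.loopHol γ := hF.hol_comp _ _
  exact (DFunLike.congr_fun h _).trans (congrArg _ (hρ γ v))

/-- Every family of lifts of a section corresponds to a smooth equivariant function. -/
theorem exists_equivariant (hJi : Function.Injective J)
    (hJ : LinearMap.range J = F.properFiber x₀.idx)
    (hρ : ∀ (γ : FundamentalGroup A x₀) v, hF.loopHol γ (J ((ρ γ).1.mulVec v)) = J v)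
    {s : Z → E} {ξ : ∀ i, (A.chart i).dom → Fin R → ℂ} (hξ : F.IsLift s ξ) :
    ∃ f ∈ equivariantFunctions ρ, hF.Corresponds J ξ f := by
  have hex : ∀ q : BasedPaths A x₀, ∃ v, hF.hol q.cls (J v) = q.endpt.eval ξ := fun q => by
    obtain ⟨u, hu, hu'⟩ := hF.exists_hol_eq q.cls (hξ.eval_mem q.endpt)
    rw [← hJ] at hu
    obtain ⟨v, rfl⟩ := hu
    exact ⟨v, hu'⟩
  have uniq : ∀ (q : BasedPaths A x₀) {v v' : Fin r → ℂ},
      hF.hol q.cls (J v) = hF.hol q.cls (J v') → v = v' := fun q v v' h =>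
    hJi (hF.hol_injOn q.cls (mem_of_range hJ _) (mem_of_range hJ _) h)
  choose f₀ hf₀ using hex
  -- Prolonging `q` by an arrow applies the same transport to the holonomy and to the value of `ξ`.
  let f : UniversalCover A x₀ → Fin r → ℂ := Quot.lift f₀ (by
    rintro q _ ⟨w, g, rfl⟩
    refine uniq (q.extendArrow g) ?_
    rw [hf₀]
    change hF.hol (q.cls.comp (PathClass.mk (.ofArrow g))) _ = w.eval ξ
    rw [hol_comp, hol_ofArrow, Module.End.mul_apply, hf₀, hξ.eval_transport])
  have hf : hF.Corresponds J ξ f := hf₀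
  refine ⟨f, ⟨fun q => ?_, fun γ x => ?_⟩, hf⟩
  · obtain ⟨τ, hτ, hτξ⟩ := hξ.smooth q.endpt.idx
    obtain ⟨K, hK⟩ := LinearMap.exists_leftInverse_of_injective J (LinearMap.ker_eq_bot.2 hJi)
    obtain ⟨d, -, -, hd⟩ := hF.exists_inverse q.cls
    -- `M` inverts `hol(q) J`. Since holonomy does not change along paths in the chart, `f` is there
    -- the fixed linear map `M` applied to the smooth lift.
    let M : (Fin R → ℂ) →ₗ[ℂ] (Fin r → ℂ) := K ∘ₗ hF.hol d
    have hM : ∀ v, M (hF.hol q.cls (J v)) = v := fun v => by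
      change K ((hF.hol d * hF.hol q.cls) (J v)) = v
      rw [hd, properProj_apply (mem_of_range hJ v)]
      exact DFunLike.congr_fun hK v
    refine ⟨(A.chart q.endpt.idx).dom, fun y => M (τ y), (A.chart q.endpt.idx).isOpen_dom,
      q.endpt.mem, ?_, fun w b _ => ?_⟩
    · exact ((LinearMap.toContinuousLinearMap M).restrictScalars ℝ).contDiff.comp_contDiffOn hτ
    · have h1 := hf (q.extend b)
      change hF.hol (q.cls.comp (PathClass.mk (.single (𝟙 _) b (𝟙 _)))) _ = w.eval ξ at h1
      rw [hol_comp_path] at h1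
      have h2 : w.eval ξ = τ w.pt := by
        have hidx := idx_eq_of_path b
        obtain ⟨i, p, hp⟩ := w
        dsimp only at hidx
        subst hidx
        exact (hτξ ⟨p, hp⟩).symm
      rw [h2] at h1
      change _ = M (τ w.pt)
      rw [← h1, hM]
  · induction x using Quot.ind with | mk q => ?_
    -- `γ x` and `x` have the same end point, so both vectors must represent the same value of `ξ`.
    refine uniq ⟨q.endpt, PathClass.comp γ q.cls⟩ ?_
    rw [hol_rep hρ γ q.cls]
    exact (hf ⟨q.endpt, PathClass.comp γ q.cls⟩).trans (hf q).symm

/-- Every smooth equivariant function corresponds to the family of lifts of a section. -/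
theorem exists_lift [ConnectedSpace Z]
    (hρ : ∀ (γ : FundamentalGroup A x₀) v, hF.loopHol γ (J ((ρ γ).1.mulVec v)) = J v)
    {f : UniversalCover A x₀ → Fin r → ℂ} (hf : f ∈ equivariantFunctions ρ) :
    ∃ ξ ∈ F.lifts, hF.Corresponds J ξ f := by
  obtain ⟨hsm, heq⟩ := hf
  -- Two paths with the same end point differ by the loop `a' d`, where `d` is an inverse of `a`.
  -- Equivariance under that loop compensates the change of holonomy.
  have hindep : ∀ {w : Obj A} (a a' : PathClass x₀ w),
      hF.hol a (J (f (UniversalCover.mk ⟨w, a⟩))) =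
        hF.hol a' (J (f (UniversalCover.mk ⟨w, a'⟩))) := by
    intro w a a'
    obtain ⟨d, hd, -, -⟩ := hF.exists_inverse a
    have h1 : UniversalCover.mk ⟨w, a'⟩ =
        UniversalCover.mk ⟨w, PathClass.comp (PathClass.comp a' d) a⟩ := by
      rw [PathClass.comp_assoc, hd]
      -- The constant loop appended to `a'` is an extension by the identity arrow, hence gives the
      -- same point of `X`.
      exact Quot.sound ⟨w, 𝟙 w, rfl⟩
    have h2 : f (UniversalCover.mk ⟨w, PathClass.comp (PathClass.comp a' d) a⟩) = _ :=
      heq (PathClass.comp a' d : PathClass x₀ x₀) (UniversalCover.mk ⟨w, a⟩)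
    have h3 := hol_rep hρ (PathClass.comp a' d : PathClass x₀ x₀) a
      (f (UniversalCover.mk ⟨w, a⟩))
    rw [← h3, h1, h2, PathClass.comp_assoc, hd, hol_comp, hol_refl, properProj_mul_hol]
  have c : ∀ x : Obj A, GPath x₀ x := fun x => (nonempty_gpath x₀ x).some
  let ξ : ∀ i, (A.chart i).dom → Fin R → ℂ := fun i x =>
    hF.hol (PathClass.mk (c ⟨i, x.1, x.2⟩))
      (J (f (UniversalCover.mk ⟨_, PathClass.mk (c ⟨i, x.1, x.2⟩)⟩)))
  have hcor : hF.Corresponds J ξ f := fun q => hindep _ _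
  have harrow : ∀ {x y : Obj A} (g : x ⟶ y), y.eval ξ = hF.transport g (x.eval ξ) := by
    intro x y g
    let q : BasedPaths A x₀ := ⟨x, PathClass.mk (c x)⟩
    have h1 := hcor (q.extendArrow g)
    have h2 : UniversalCover.mk (q.extendArrow g) = UniversalCover.mk q :=
      (Quot.sound ⟨y, g, rfl⟩).symm
    rw [h2] at h1
    change hF.hol (q.cls.comp (PathClass.mk (.ofArrow g))) _ = y.eval ξ at h1
    rw [hol_comp, hol_ofArrow, Module.End.mul_apply, hcor q] at h1
    exact h1.symm
  have hmem : ∀ x : Obj A, x.eval ξ ∈ F.properFiber x.idx := fun x => hF.hol_mem _ _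
  have hinv : ∀ (x : Obj A) (k : (F.chart x.idx).GE),
      (x.smul ((F.chart x.idx).toG k)).eval ξ = ((F.chart x.idx).rep k).1.mulVec (x.eval ξ) :=
    fun x k => by
      rw [harrow (x.smulHom _), hF.transport_apply (isTransport_smulHom x k) (hmem x)]
  -- A transition matrix `L` over a single point need not be the transport of any arrow. Its value
  -- and the transported one have the same image in the total space, so they differ by an isotropy
  -- element `k`, which `hinv` shows to fix the value of `ξ`.
  obtain ⟨s, hs, hsξ⟩ := F.exists_of_transition ξ (fun i j x y L hxy hL => by
    obtain ⟨g⟩ := nonempty_hom_of_toBase_eq (x := (⟨i, x.1, x.2⟩ : Obj A))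
      (y := ⟨j, y.1, y.2⟩) hxy
    have h1 := hF.point_transport g (hmem ⟨i, x.1, x.2⟩)
    rw [← harrow g] at h1
    obtain ⟨k, hk, hk'⟩ := ((F.chart j).proj_eq_iff _ y.2 _ y.2 _ _).1 (h1.trans (hL _).symm)
    have h2 := hinv ⟨j, y.1, y.2⟩ k
    have h3 : (⟨j, y.1, y.2⟩ : Obj A).smul ((F.chart j).toG k) = ⟨j, y.1, y.2⟩ := by
      ext1
      · rfl
      · exact hk
    rw [h3] at h2
    exact h2.trans hk')
  refine ⟨ξ, ⟨s, hs, ⟨fun i => ?_, hsξ, fun i k x => hinv ⟨i, x.1, x.2⟩ k⟩⟩, hcor⟩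
  classical
  -- The value `0` off the open chart domain plays no role, smoothness being required on the domain
  -- only.
  refine ⟨fun p => if h : p ∈ (A.chart i).dom then ξ i ⟨p, h⟩ else 0, fun p hp => ?_,
    fun x => by simp⟩
  refine ContDiffAt.contDiffWithinAt ?_
  let q : BasedPaths A x₀ := ⟨⟨i, p, hp⟩, PathClass.mk (c ⟨i, p, hp⟩)⟩
  obtain ⟨N, φ, hN, hpN, hφ, hφf⟩ := hsm q
  -- In a ball each `y` is joined to `p` by a segment staying in `N` and in the chart, so the local
  -- formula for `f` applies and `ξ` equals `hol(q) J φ` near `p`.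
  obtain ⟨ε, hε, hball⟩ := Metric.isOpen_iff.1 (hN.inter (A.chart i).isOpen_dom) p ⟨hpN, hp⟩
  have hlin : ContDiffAt ℝ ∞ (fun y => (hF.hol q.cls ∘ₗ J) (φ y)) p :=
    ((LinearMap.toContinuousLinearMap (hF.hol q.cls ∘ₗ J)).restrictScalars
      ℝ).contDiff.contDiffAt.comp p (hφ.contDiffAt (hN.mem_nhds hpN))
  refine hlin.congr_of_eventuallyEq ?_
  filter_upwards [Metric.ball_mem_nhds p hε] with y hy
  have hj : JoinedIn (Metric.ball p ε) p y :=
    JoinedIn.of_segment_subset ((convex_ball p ε).segment_subset (Metric.mem_ball_self hε) hy)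
  have hyd : y ∈ (A.chart i).dom := (hball hy).2
  obtain ⟨b, hb⟩ := exists_path_of_joinedIn (A := A) (i := i) (fun z hz => (hball hz).2) hj
  have h1 := hcor (q.extend b)
  rw [hφf _ b fun u => (hball (hb u)).1] at h1
  change hF.hol (q.cls.comp (PathClass.mk (.single (𝟙 _) b (𝟙 _)))) _ = ξ i ⟨y, hyd⟩ at h1
  rw [hol_comp_path] at h1
  rw [dif_pos hyd, ← h1]
  rfl

end IsFlat

variable (F) in
/-- Taking invariant lifts is linear. -/
def liftLinearEquiv : F.SmoothSection ≃ₗ[ℂ] F.lifts where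
  __ := F.sectionEquivLifts
  -- The operations on sections are transported from those on lifts, so linearity is the
  -- cancellation of the bijection with its inverse.
  map_add' _ _ := F.sectionEquivLifts.apply_symm_apply _
  map_smul' _ _ := F.sectionEquivLifts.apply_symm_apply _

theorem lift_liftLinearEquiv (s : F.SmoothSection) : F.IsLift s.1 (F.liftLinearEquiv s).1 :=
  s.isLift

/-- Lifts of sections are in linear bijection with smooth equivariant functions. -/
theorem IsFlat.exists_linearEquiv [ConnectedSpace Z] {x₀ : Obj A} {r : ℕ}
    {J : (Fin r → ℂ) →ₗ[ℂ] (Fin R → ℂ)}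
    {ρ : FundamentalGroup A x₀ →* Matrix.GeneralLinearGroup (Fin r) ℂ}
    (hJi : Function.Injective J) (hJ : LinearMap.range J = F.properFiber x₀.idx)
    (hρ : ∀ (γ : FundamentalGroup A x₀) v, hF.loopHol γ (J ((ρ γ).1.mulVec v)) = J v) :
    ∃ e : F.lifts ≃ₗ[ℂ] equivariantFunctions ρ, ∀ ξ, hF.Corresponds J ξ.1 (e ξ).1 := by
  have hex : ∀ ξ : F.lifts, ∃ f : equivariantFunctions ρ, hF.Corresponds J ξ.1 f.1 := fun ξ => by
    obtain ⟨s, -, hs⟩ := ξ.2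
    obtain ⟨f, hf, h⟩ := exists_equivariant hJi hJ hρ hs
    exact ⟨⟨f, hf⟩, h⟩
  choose f hf using hex
  let D : F.lifts →ₗ[ℂ] equivariantFunctions ρ :=
    { toFun := f
      map_add' := fun ξ ξ' => Subtype.ext ((hf _).right_unique hJi hJ ((hf ξ).add (hf ξ')))
      map_smul' := fun a ξ => Subtype.ext ((hf _).right_unique hJi hJ ((hf ξ).smul a)) }
  refine ⟨LinearEquiv.ofBijective D ⟨fun ξ ξ' h => Subtype.ext ((hf ξ).left_unique ?_),
    fun g => ?_⟩, hf⟩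
  · change f ξ = f ξ' at h
    rw [h]
    exact hf ξ'
  · obtain ⟨ξ, hξ, h⟩ := exists_lift hρ g.2
    exact ⟨⟨ξ, hξ⟩, Subtype.ext ((hf _).right_unique hJi hJ h)⟩

end OrbifoldVectorBundle

end Orbifold

end

/-! ### The representation, the covering map and the isomorphism together -/

theorem corollary0p2 {Z : Type*} [TopologicalSpace Z] [T2Space Z] [SecondCountableTopology Z]
    [ConnectedSpace Z] {ι : Type*} {m : ℕ} (A : Orbifold.OrbifoldAtlas ι Z m)
    {E : Type*} [TopologicalSpace E] [T2Space E] [SecondCountableTopology E] {R : ℕ}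
    (F : Orbifold.OrbifoldVectorBundle A E R) (hF : F.IsFlat) (x₀ : Orbifold.Obj A) :
    ∃ (r : ℕ) (ρ : Orbifold.FundamentalGroup A x₀ →* Matrix.GeneralLinearGroup (Fin r) ℂ)
      (Φ : Orbifold.UniversalCover A x₀ → (Fin r → ℂ) → E),
      (∀ γ x v, Φ (γ • x) ((ρ γ).1.mulVec v) = Φ x v) ∧
      (∀ q : Orbifold.BasedPaths A x₀, ∃ T : (Fin r → ℂ) →ₗ[ℂ] (Fin R → ℂ),
        Function.Injective T ∧ LinearMap.range T = F.properFiber q.endpt.idx ∧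
        ∀ (w : Orbifold.Obj A) (b : Path q.endpt w) (v : Fin r → ℂ),
          Φ (Orbifold.UniversalCover.mk (q.extend b)) v = F.point w (T v)) ∧
      ∃ e : F.SmoothSection ≃ₗ[ℂ] Orbifold.equivariantFunctions ρ,
        ∀ (s : F.SmoothSection) (x : Orbifold.UniversalCover A x₀),
          s.1 x.proj = Φ x ((e s).1 x) := by
  obtain ⟨r, J, ρ, hJi, hJ, hρ⟩ := hF.exists_rep x₀
  obtain ⟨e, he⟩ := hF.exists_linearEquiv hJi hJ hρ
  -- `T` is the holonomy of `q` after the basis `J`: injective, with image the whole proper fibre at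
  -- the end point.
  refine ⟨r, ρ, hF.coverMap J, fun γ x v => ?_, fun q => ⟨hF.hol q.cls ∘ₗ J, ?_, ?_, ?_⟩,
    F.liftLinearEquiv.trans e, fun s x => ?_⟩
  · induction x using Quot.ind with | mk q => ?_
    exact congrArg (F.point q.endpt) (Orbifold.OrbifoldVectorBundle.IsFlat.hol_rep hρ γ q.cls v)
  · exact fun v v' h => hJi (hF.hol_injOn q.cls (Orbifold.OrbifoldVectorBundle.IsFlat.mem_of_range hJ _) (Orbifold.OrbifoldVectorBundle.IsFlat.mem_of_range hJ _) h)
  · refine le_antisymm ?_ fun u hu => ?_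
    · rintro _ ⟨v, rfl⟩
      exact hF.hol_mem _ _
    · obtain ⟨v, hv, rfl⟩ := hF.exists_hol_eq q.cls hu
      rw [← hJ] at hv
      obtain ⟨v, rfl⟩ := hv
      exact ⟨v, rfl⟩
  · intro w b v
    change F.point w (hF.hol (q.cls.comp (Orbifold.PathClass.mk (.single (𝟙 _) b (𝟙 _)))) (J v)) = _
    rw [Orbifold.OrbifoldVectorBundle.IsFlat.hol_comp_path]
    rfl
  · induction x using Quot.ind with | mk q => ?_
    have h1 := (Orbifold.OrbifoldVectorBundle.lift_liftLinearEquiv s).point_eval q.endpt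
    rw [← he (F.liftLinearEquiv s) q] at h1
    exact h1.symm
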